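/- Let $I$ be a finite set. A forest on $I$ is a set of rooted binary trees (non-planar, taken up to label-preserving isomorphism) whose leaves are bijectively labeled by $I$; edges are oriented towards the roots, and the inner vertices are the vertices that are neither leaves nor roots. For forests $F,F'$ on $I$ put $F\le F'$ if there is a topological map $F\to F'$ that is increasing for the orientation towards the root, maps inner vertices to inner vertices injectively, is the identity of $I$ on leaves, and is injective on each tree of $F$. Up to isotopy such a map is described by the images of the vertices of $F$. This relation is a partial order on the finite set $\operatorname{For}(I)$ of forests on $I$. For a finite poset $P$ with least element $\hat 0$, greatest element $\hat 1$, Möbius function $\mu$ and rank function $\operatorname{rk}$ ($\operatorname{rk}(a)$ is the maximal length of a chain with greatest element $a$), let $\chi_P(y)=\sum_{b\in P}\mu(\hat 0,b)\,y^{\operatorname{rk}(\hat 1)-\operatorname{rk}(b)}$ be its characteristic polynomial and $\mu(P)=\mu(\hat 0,\hat 1)$ its Möbius number. Let $F\le F'$ in $\operatorname{For}(I)$, and fix a map $F\to F'$ as above. The marked vertices of $F'$ are the images of the inner vertices of $F$; let $N$ be the set of non-marked inner vertices of $F'$. For $v\in N$ let $T_1,T_2$ be the two subtrees of $F'$ grafted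 at $v$, let $d_i$ be the number of leaves of $T_i$ minus the number of marked vertices of $T_i$, and let $e(v)=d_1d_2$ be the exponent of $v$. **Theorem.** For the interval $[F,F']$ of $\operatorname{For}(I)$, $$\chi_{[F,F']}(y)=\prod_{v\in N}\bigl(y-e(v)\bigr),$$ and $e(v)>0$ for every $v\in N$. Thus the complex roots of $\chi_{[F,F']}$, with multiplicity, are the positive integers $e(v)$, $v\in N$. As a consequence $$\mu([F,F'])=(-1)^{|N|}\prod_{v\in N}e(v).$$ -/

import Mathlib

/-! ### Leaf-labeled forests of rooted binary trees -/

/-- A forest of rooted binary trees with leaves bijectively labeled by `I` (not planar, up to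
label-preserving isomorphism). A vertex (a leaf or an inner vertex) is identified with the set of
its ancestor leaves, i.e. the leaves whose path to the root goes through this vertex, so that a
forest is recorded as its set of vertices, which is a set of non-empty subsets of `I`. The leaf `i`
is `{i}`; two vertices are either one below the other or have disjoint sets of ancestors; and at a
vertex which is not a leaf two subtrees are grafted. The trees of the forest
correspond to the maximal elements of `verts`. -/
@[ext]
structure BinForest (I : Type*) [DecidableEq I] where
  verts : Finset (Finset I)
  nonempty_of_mem : ∀ A ∈ verts, A.Nonempty
  singleton_mem : ∀ i, {i} ∈ verts
  laminar : ∀ A ∈ verts, ∀ B ∈ verts, A ⊆ B ∨ B ⊆ A ∨ Disjoint A B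
  binary : ∀ A ∈ verts, 1 < A.card → ∃ B ∈ verts, ∃ C ∈ verts, Disjoint B C ∧ B ∪ C = A

namespace BinForest

variable {I : Type*} [DecidableEq I]

/-- The vertices of a forest (leaves and inner vertices). They are ordered by inclusion of the sets
of ancestor leaves: `v ≤ w` means that `w` lies on the path from `v` to the root, i.e. vertices
increase towards the root. -/
abbrev Vertex (F : BinForest I) : Type _ := {A : Finset I // A ∈ F.verts}

/-- The leaf with label `i`. -/
def leaf (F : BinForest I) (i : I) : F.Vertex := ⟨{i}, F.singleton_mem i⟩

/-- A vertex is inner if it is not a leaf. -/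
def IsInner {F : BinForest I} (v : F.Vertex) : Prop := 1 < v.1.card

instance {F : BinForest I} (v : F.Vertex) : Decidable (IsInner v) :=
  inferInstanceAs (Decidable (1 < v.1.card))

/-- The set of inner vertices. -/
def inner (F : BinForest I) : Finset F.Vertex := Finset.univ.filter fun v => IsInner v

/-- Two vertices are in the same tree if their paths to the root meet. -/
def SameTree {F : BinForest I} (v w : F.Vertex) : Prop := ∃ u, v ≤ u ∧ w ≤ u

/-- The roots of the subtrees grafted at the vertex `v`: the vertices joined to `v` by an
edge oriented from them to `v`. -/
noncomputable def children {F : BinForest I} (v : F.Vertex) : Finset F.Vertex :=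
  open Classical in Finset.univ.filter fun u => u ⋖ v

/-- The edges of `F'`, each of them being represented by its source, on which the outgoing edge
(the edge towards the root) of the vertex `v` of `F` is laid by a map sending vertices by `φ`:
the directed path that starts at `φ v` and stops at the image of the next vertex of `F` below `v`
(the directed path to the root if there is no vertex below `v`). -/
def edgePath {F F' : BinForest I} (φ : F.Vertex → F'.Vertex) (v : F.Vertex) : Set F'.Vertex :=
  {x | φ v ≤ x ∧ ∀ w, v < w → x < φ w}

/-- A topological map from `F` to `F'` up to isotopy, described by the images of the vertices; every
edge is mapped to the directed path joining the images of its ends. -/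
structure Map (F F' : BinForest I) where
  toFun : F.Vertex → F'.Vertex
  /-- increasing with respect to the orientation towards the root -/
  monotone : Monotone toFun
  /-- inner vertices are mapped to inner vertices -/
  isInner : ∀ v, IsInner v → IsInner (toFun v)
  /-- injective on inner vertices -/
  injOn_inner : Set.InjOn toFun {v | IsInner v}
  /-- the identity of `I` on leaves -/
  map_leaf : ∀ i, toFun (F.leaf i) = F'.leaf i
  /-- injective on each tree: distinct vertices have distinct images, and distinct edges are laid
  on paths without a common edge -/
  injective_tree : ∀ v w, SameTree v w → v ≠ w →
    toFun v ≠ toFun w ∧ Disjoint (edgePath toFun v) (edgePath toFun w)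

theorem comparable {F : BinForest I} {u v w : F.Vertex} (hv : u ≤ v) (hw : u ≤ w) :
    v ≤ w ∨ w ≤ v := by
  rcases F.laminar v.1 v.2 w.1 w.2 with h | h | h
  · exact Or.inl h
  · exact Or.inr h
  · obtain ⟨i, hi⟩ := F.nonempty_of_mem u.1 u.2
    exact absurd (hw hi) (Finset.disjoint_left.1 h (hv hi))

theorem lt_or_le {F : BinForest I} {u v w : F.Vertex} (hv : u ≤ v) (hw : u ≤ w) :
    v < w ∨ w ≤ v := by
  rcases comparable hv hw with h | h
  · rcases h.lt_or_eq with h | h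
    · exact Or.inl h
    · exact Or.inr h.ge
  · exact Or.inr h

theorem sameTree_of_le {F : BinForest I} {v w v' w' : F.Vertex} (h : SameTree v w)
    (hv : v ≤ v') (hw : w ≤ w') : SameTree v' w' := by
  obtain ⟨u, hu, hu'⟩ := h
  rcases comparable hv hu with h1 | h1 <;> rcases comparable hw hu' with h2 | h2
  · exact ⟨u, h1, h2⟩
  · exact ⟨w', h1.trans h2, le_rfl⟩
  · exact ⟨v', le_rfl, h2.trans h1⟩
  · rcases comparable h1 h2 with h3 | h3
    · exact ⟨w', h3, le_rfl⟩
    · exact ⟨v', le_rfl, h3⟩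

theorem Map.le_map {F F' : BinForest I} (f : Map F F') (v : F.Vertex) :
    v.1 ⊆ (f.toFun v).1 := by
  intro i hi
  have h : F.leaf i ≤ v := by
    change ({i} : Finset I) ⊆ v.1
    simpa using hi
  have h2 := f.monotone h
  rw [f.map_leaf] at h2
  have h3 : ({i} : Finset I) ⊆ (f.toFun v).1 := h2
  simpa using h3

def Map.id (F : BinForest I) : Map F F where
  toFun v := v
  monotone := monotone_id
  isInner _ h := h
  injOn_inner _ _ _ _ h := h
  map_leaf _ := rfl
  injective_tree v w _ hne := by
    refine ⟨hne, Set.disjoint_left.2 ?_⟩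
    rintro x ⟨h1, h2⟩ ⟨h3, h4⟩
    have e1 : v = x := h1.eq_or_lt.resolve_right fun h => lt_irrefl _ (h2 x h)
    have e2 : w = x := h3.eq_or_lt.resolve_right fun h => lt_irrefl _ (h4 x h)
    exact hne (e1.trans e2.symm)

theorem exists_mem_edgePath {F F' F'' : BinForest I} (f : Map F F') (g : Map F' F'')
    {v : F.Vertex} {x : F''.Vertex} (hx : x ∈ edgePath (fun v => g.toFun (f.toFun v)) v) :
    ∃ y, y ∈ edgePath f.toFun v ∧ x ∈ edgePath g.toFun y := by
  obtain ⟨h1, h2⟩ := hx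
  obtain ⟨y, hy⟩ := (Set.toFinite {y : F'.Vertex | f.toFun v ≤ y ∧ g.toFun y ≤ x}).exists_maximal
    ⟨f.toFun v, le_rfl, h1⟩
  obtain ⟨⟨ha, hb⟩, hmax⟩ := hy
  refine ⟨y, ⟨ha, fun u hu => ?_⟩, hb, fun z hz => ?_⟩
  · rcases lt_or_le ha (f.monotone hu.le) with h | h
    · exact h
    · exact absurd ((g.monotone h).trans hb) (h2 u hu).not_ge
  · rcases lt_or_le hb (g.monotone hz.le) with h | h
    · exact h
    · exact absurd (hmax ⟨ha.trans hz.le, h⟩ hz.le) hz.not_ge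

def Map.comp {F F' F'' : BinForest I} (g : Map F' F'') (f : Map F F') : Map F F'' where
  toFun v := g.toFun (f.toFun v)
  monotone := g.monotone.comp f.monotone
  isInner v h := g.isInner _ (f.isInner v h)
  injOn_inner v hv w hw h :=
    f.injOn_inner hv hw (g.injOn_inner (f.isInner v hv) (f.isInner w hw) h)
  map_leaf i := by rw [f.map_leaf, g.map_leaf]
  injective_tree v w hs hne := by
    obtain ⟨u, hu, hu'⟩ := hs
    obtain ⟨h1, h2⟩ := f.injective_tree v w ⟨u, hu, hu'⟩ hne
    have hs' : SameTree (f.toFun v) (f.toFun w) := ⟨f.toFun u, f.monotone hu, f.monotone hu'⟩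
    refine ⟨(g.injective_tree _ _ hs' h1).1, Set.disjoint_left.2 fun x hx hx' => ?_⟩
    obtain ⟨y, hy, hxy⟩ := exists_mem_edgePath f g hx
    obtain ⟨z, hz, hxz⟩ := exists_mem_edgePath f g hx'
    by_cases hyz : y = z
    · subst hyz
      exact Set.disjoint_left.1 h2 hy hz
    · exact Set.disjoint_left.1
        (g.injective_tree y z (sameTree_of_le hs' hy.1 hz.1) hyz).2 hxy hxz

theorem isInner_or_leaf {F : BinForest I} (v : F.Vertex) : IsInner v ∨ ∃ i, v = F.leaf i := by
  by_cases h : IsInner v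
  · exact Or.inl h
  · right
    have h1 : v.1.card = 1 :=
      le_antisymm (not_lt.1 h) (Finset.card_pos.2 (F.nonempty_of_mem v.1 v.2))
    obtain ⟨i, hi⟩ := Finset.card_eq_one.1 h1
    exact ⟨i, Subtype.ext hi⟩

theorem not_isInner_leaf (F : BinForest I) (i : I) : ¬ IsInner (F.leaf i) := by
  simp [IsInner, leaf]

theorem Map.eq_self {F : BinForest I} (f : Map F F) (v : F.Vertex) : f.toFun v = v := by
  have hinj : Function.Injective f.toFun := by
    intro v w h
    rcases isInner_or_leaf v with hv | ⟨i, rfl⟩ <;> rcases isInner_or_leaf w with hw | ⟨j, rfl⟩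
    · exact f.injOn_inner hv hw h
    · have := f.isInner v hv
      rw [h, f.map_leaf] at this
      exact absurd this (not_isInner_leaf F j)
    · have := f.isInner w hw
      rw [← h, f.map_leaf] at this
      exact absurd this (not_isInner_leaf F i)
    · rwa [f.map_leaf, f.map_leaf] at h
  have hbij : Function.Bijective f.toFun := Finite.injective_iff_bijective.1 hinj
  have hsum : ∑ v : F.Vertex, v.1.card = ∑ v : F.Vertex, (f.toFun v).1.card :=
    (hbij.sum_comp fun v : F.Vertex => v.1.card).symm
  have hcard := (Finset.sum_eq_sum_iff_of_le
    fun v _ => Finset.card_le_card (f.le_map v)).1 hsum v (Finset.mem_univ v)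
  exact Subtype.ext (Finset.eq_of_subset_of_card_le (f.le_map v) hcard.ge).symm

theorem verts_subset {F F' : BinForest I} (f : Map F F') (g : Map F' F) : F.verts ⊆ F'.verts := by
  intro A hA
  have h1 := f.le_map ⟨A, hA⟩
  have h2 := g.le_map (f.toFun ⟨A, hA⟩)
  have h3 : g.toFun (f.toFun ⟨A, hA⟩) = ⟨A, hA⟩ := (g.comp f).eq_self ⟨A, hA⟩
  rw [h3] at h2
  have h4 : (f.toFun ⟨A, hA⟩).1 = A := Finset.Subset.antisymm h2 h1
  rw [← h4]
  exact (f.toFun ⟨A, hA⟩).2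

/-- The poset of forests on `I`: `F ≤ F'` if there is a map from `F` to `F'`. -/
instance : PartialOrder (BinForest I) where
  le F F' := Nonempty (Map F F')
  le_refl F := ⟨Map.id F⟩
  le_trans _ _ _ h h' := ⟨h'.some.comp h.some⟩
  le_antisymm _ _ h h' := BinForest.ext
    (Finset.Subset.antisymm (verts_subset h.some h'.some) (verts_subset h'.some h.some))

instance [Finite I] : Finite (BinForest I) :=
  Finite.of_injective BinForest.verts fun _ _ h => BinForest.ext h

/-- At every inner vertex exactly two subtrees are grafted. -/
theorem card_children {F : BinForest I} (v : F.Vertex) (hv : IsInner v) :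
    (children v).card = 2 := by
  classical
  obtain ⟨B, hB, C, hC, hd, hu⟩ := F.binary v.1 v.2 hv
  obtain ⟨b, hb⟩ := F.nonempty_of_mem B hB
  obtain ⟨c, hc⟩ := F.nonempty_of_mem C hC
  have hBv : B ⊆ v.1 := hu ▸ Finset.subset_union_left
  have hCv : C ⊆ v.1 := hu ▸ Finset.subset_union_right
  have hBl : (⟨B, hB⟩ : F.Vertex) < v := lt_of_le_of_ne hBv fun h =>
    Finset.disjoint_left.1 hd ((show B = v.1 from congrArg Subtype.val h).ge (hCv hc)) hc
  have hCl : (⟨C, hC⟩ : F.Vertex) < v := lt_of_le_of_ne hCv fun h =>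
    Finset.disjoint_left.1 hd hb ((show C = v.1 from congrArg Subtype.val h).ge (hBv hb))
  have key : ∀ D : F.Vertex, D < v → D ≤ ⟨B, hB⟩ ∨ D ≤ ⟨C, hC⟩ := by
    intro D hD
    by_contra hcon
    obtain ⟨h1, h2⟩ := not_or.1 hcon
    have hD' : D.1 ⊆ B ∪ C := hu ▸ hD.le
    have h3 : C ⊆ D.1 := by
      rcases F.laminar D.1 D.2 C hC with h | h | h
      · exact absurd h h2
      · exact h
      · exact absurd (fun x hx => (Finset.mem_union.1 (hD' hx)).resolve_right
          (Finset.disjoint_left.1 h hx)) h1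
    have h4 : B ⊆ D.1 := by
      rcases F.laminar D.1 D.2 B hB with h | h | h
      · exact absurd h h1
      · exact h
      · exact absurd (fun x hx => (Finset.mem_union.1 (hD' hx)).resolve_left
          (Finset.disjoint_left.1 h hx)) h2
    exact hD.not_ge (show v.1 ⊆ D.1 from hu ▸ Finset.union_subset h4 h3)
  have hne : (⟨B, hB⟩ : F.Vertex) ≠ ⟨C, hC⟩ := fun h =>
    Finset.disjoint_left.1 hd hb ((show B = C from congrArg Subtype.val h).le hb)
  have hset : children v = {⟨B, hB⟩, ⟨C, hC⟩} := by
    ext D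
    simp only [children, Finset.mem_filter, Finset.mem_univ, true_and, Finset.mem_insert,
      Finset.mem_singleton]
    constructor
    · intro hD
      rcases key D hD.lt with h | h
      · exact Or.inl (h.eq_or_lt.resolve_right fun h' => hD.2 h' hBl)
      · exact Or.inr (h.eq_or_lt.resolve_right fun h' => hD.2 h' hCl)
    · rintro (rfl | rfl)
      · refine ⟨hBl, fun E hE hEv => ?_⟩
        rcases key E hEv with h | h
        · exact hE.not_ge h
        · exact Finset.disjoint_left.1 hd hb (h (hE.le hb))
      · refine ⟨hCl, fun E hE hEv => ?_⟩
        rcases key E hEv with h | h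
        · exact Finset.disjoint_left.1 hd (h (hE.le hc)) hc
        · exact hE.not_ge h
  rw [hset, Finset.card_pair hne]

/-! ### Marked vertices and exponents -/

/-- The marked vertices of `F'`: the image of the inner vertices of `F`. -/
def Map.marked {F F' : BinForest I} (f : Map F F') : Finset F'.Vertex := F.inner.image f.toFun

/-- The inner vertices of `F'` which are not marked. -/
def Map.nonMarked {F F' : BinForest I} (f : Map F F') : Finset F'.Vertex := F'.inner \ f.marked

/-- For the subtree with lowest vertex `u`: its number of leaves minus its number of marked
vertices. -/
def Map.subtreeCount {F F' : BinForest I} (f : Map F F') (u : F'.Vertex) : ℤ :=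
  (u.1.card : ℤ) - ((f.marked.filter fun w => w ≤ u).card : ℤ)

/-- The exponent `d₁ d₂` of a vertex, the product over its two subtrees. -/
noncomputable def Map.exponent {F F' : BinForest I} (f : Map F F') (v : F'.Vertex) : ℤ :=
  ∏ u ∈ children v, f.subtreeCount u

end BinForest

/-! ### Finite posets with least and greatest elements -/

/-- The Möbius function of a finite poset. -/
noncomputable def posetMu {P : Type*} [PartialOrder P] [Finite P] (a b : P) : ℤ := by
  classical
  letI := Fintype.ofFinite P
  letI : LocallyFiniteOrder P := Fintype.toLocallyFiniteOrder
  exact IncidenceAlgebra.mu ℤ a b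

/-- The rank function: the maximal length of a chain with greatest element `a` (in a
ranked poset, the length of every maximal chain below `a`). -/
noncomputable def posetRank {P : Type*} [PartialOrder P] (a : P) : ℕ := (Order.height a).toNat

/-- The corank function `crk a = rk 1 - rk a`. -/
noncomputable def posetCorank {P : Type*} [PartialOrder P] [BoundedOrder P] (a : P) : ℕ :=
  posetRank (⊤ : P) - posetRank a

/-- The characteristic polynomial `∑ b, μ(0, b) y ^ crk b`. -/
noncomputable def posetCharPoly (P : Type*) [PartialOrder P] [BoundedOrder P] [Finite P] :
    Polynomial ℤ :=
  letI := Fintype.ofFinite P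
  ∑ b : P, Polynomial.C (posetMu ⊥ b) * Polynomial.X ^ posetCorank b

/-- The Möbius number `μ(0, 1)`. -/
noncomputable def moebiusNumber (P : Type*) [PartialOrder P] [BoundedOrder P] [Finite P] : ℤ :=
  posetMu (⊥ : P) ⊤

namespace BinForest

variable {I : Type*} [DecidableEq I]

/-! ### Least vertices above a set of leaves -/

/-! A map has no freedom: it must send a vertex to the least vertex of `F'` whose leaf set contains
that of the given vertex (`Map.isLca`). Conversely, this assignment is a map as soon as it is
defined and injective on inner vertices. So `F ≤ F'` becomes a statement about leaf sets (`le_iff`).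

Let `F'` arise from `F₁` by grafting two trees `U₁`, `U₂` at a new vertex. A forest below `F'`
either lies below `F₁`, or arises from some `H ≤ F₁` by grafting a tree inside `U₁` to a tree inside
`U₂`. The cases exclude each other, and the data of the second are unique (`IsJoin.le_iff`,
`IsJoin.not_le`, `IsJoin.unique`). This gives an induction on pairs `F ≤ F'` with an unmarked and a
marked step.

Let `wt F G` be the product of the negated exponents. The sum of `wt F G * y ^ crk G` over the
interval is shown to be the product of the `y - e(v)` (`sum_wt_mul_pow`). In the marked step the
interval is in bijection with the smaller one, and weights are preserved. In the unmarked step, the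
`G ≤ F₁` contribute `y` times the old sum. The others are indexed by some `G` in `[F, F₁]` and a
pair of its trees `T₁ ⊆ U₁`, `T₂ ⊆ U₂`, with extra weight `-d(T₁) d(T₂)`. Here `d` counts the trees
of `F` inside a set, hence is additive over the trees of `G`, and the pairs add up to `-d(U₁) d(U₂)`
whatever `G` is. This yields the factor `y - d(U₁) d(U₂)`.

Only afterwards is `wt` identified with the Möbius function: if `F ≠ F'`, some exponent equals 1, so
at `y = 1` the weights add up to zero (`sum_wt`). The rank is the number of inner vertices gained.
-/

/-- `X` is the least vertex of `F` whose set of ancestor leaves contains `A`. -/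
def IsLca (F : BinForest I) (A X : Finset I) : Prop :=
  X ∈ F.verts ∧ A ⊆ X ∧ ∀ Y ∈ F.verts, A ⊆ Y → X ⊆ Y

/-- The sets of ancestor leaves of the inner vertices. -/
def inn (F : BinForest I) : Finset (Finset I) := F.verts.filter fun A => 1 < A.card

theorem mem_inn {F : BinForest I} {A : Finset I} : A ∈ F.inn ↔ A ∈ F.verts ∧ 1 < A.card := by
  simp [inn]

theorem IsLca.unique {F : BinForest I} {A X Y : Finset I} (hX : F.IsLca A X) (hY : F.IsLca A Y) :
    X = Y :=
  (hX.2.2 Y hY.1 hY.2.1).antisymm (hY.2.2 X hX.1 hX.2.1)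

theorem comparable_of_mem {F : BinForest I} {A B : Finset I} (hA : A ∈ F.verts) (hB : B ∈ F.verts)
    {i : I} (hi : i ∈ A) (hi' : i ∈ B) : A ⊆ B ∨ B ⊆ A := by
  rcases F.laminar A hA B hB with h | h | h
  · exact Or.inl h
  · exact Or.inr h
  · exact absurd hi' (Finset.disjoint_left.1 h hi)

/-- By laminarity the vertices containing a nonempty set form a chain, so one of minimal cardinality
is the least. -/
theorem exists_isLca {F : BinForest I} {A X : Finset I} (hA : A.Nonempty) (hX : X ∈ F.verts)
    (hAX : A ⊆ X) : ∃ Y, F.IsLca A Y := by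
  obtain ⟨i, hi⟩ := hA
  obtain ⟨Y, hY, hmin⟩ := Finset.exists_min_image (F.verts.filter fun Y => A ⊆ Y) Finset.card
    ⟨X, by simp [hX, hAX]⟩
  simp only [Finset.mem_filter] at hY hmin
  refine ⟨Y, hY.1, hY.2, fun Z hZ hAZ => ?_⟩
  rcases comparable_of_mem hY.1 hZ (hY.2 hi) (hAZ hi) with h | h
  · exact h
  · exact (Finset.eq_of_subset_of_card_le h (hmin Z ⟨hZ, hAZ⟩)).ge

theorem isLca_singleton (F : BinForest I) (i : I) : F.IsLca {i} {i} :=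
  ⟨F.singleton_mem i, subset_rfl, fun _ _ h => h⟩

theorem mem_inn_or_singleton {F : BinForest I} {A : Finset I} (hA : A ∈ F.verts) :
    A ∈ F.inn ∨ ∃ i, A = {i} := by
  rcases isInner_or_leaf (⟨A, hA⟩ : F.Vertex) with h | ⟨i, h⟩
  · exact Or.inl (mem_inn.2 ⟨hA, h⟩)
  · exact Or.inr ⟨i, congrArg Subtype.val h⟩

/-- At an inner vertex two disjoint subtrees are grafted, and every vertex strictly above lies in
one of them. -/
theorem exists_split {F : BinForest I} {A : Finset I} (hA : A ∈ F.inn) :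
    ∃ B ∈ F.verts, ∃ C ∈ F.verts, Disjoint B C ∧ B ∪ C = A ∧ B ⊂ A ∧ C ⊂ A ∧
      ∀ D ∈ F.verts, D ⊂ A → D ⊆ B ∨ D ⊆ C := by
  obtain ⟨hA, hc⟩ := mem_inn.1 hA
  obtain ⟨B, hB, C, hC, hd, rfl⟩ := F.binary A hA hc
  obtain ⟨b, hb⟩ := F.nonempty_of_mem B hB
  obtain ⟨c, hc⟩ := F.nonempty_of_mem C hC
  refine ⟨B, hB, C, hC, hd, rfl, ⟨Finset.subset_union_left, fun h => ?_⟩,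
    ⟨Finset.subset_union_right, fun h => ?_⟩, fun D hD hDA => ?_⟩
  · exact Finset.disjoint_left.1 hd (h (Finset.mem_union_right _ hc)) hc
  · exact Finset.disjoint_left.1 hd hb (h (Finset.mem_union_left _ hb))
  · by_contra hcon
    obtain ⟨h1, h2⟩ := not_or.1 hcon
    rcases F.laminar D hD B hB with h | h | h
    · exact h1 h
    · rcases F.laminar D hD C hC with h' | h' | h'
      · exact h2 h'
      · exact hDA.2 (Finset.union_subset h h')
      · exact h1 fun x hx => (Finset.mem_union.1 (hDA.1 hx)).resolve_right
          (Finset.disjoint_left.1 h' hx)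
    · exact h2 fun x hx => (Finset.mem_union.1 (hDA.1 hx)).resolve_left
          (Finset.disjoint_left.1 h hx)

/-- If a smaller vertex contained the leaves of `v`, it would lie in one of the two subtrees at the
image of `v`. Both children of `v` would then be sent into that subtree, so its outgoing edge would
be covered twice, against injectivity on trees. In particular there is at most one map `F → F'`. -/
theorem Map.isLca {F F' : BinForest I} (f : Map F F') (v : F.Vertex) :
    F'.IsLca v.1 (f.toFun v).1 := by
  rcases isInner_or_leaf v with hv | ⟨i, rfl⟩
  swap
  · rw [f.map_leaf]; exact isLca_singleton F' i
  refine ⟨(f.toFun v).2, f.le_map v, fun Y hY hvY => ?_⟩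
  by_contra hcon
  obtain ⟨B, hB, C, hC, hd, hu, hBv, hCv, -⟩ := exists_split (mem_inn.2 ⟨v.2, hv⟩)
  obtain ⟨B', hB', C', hC', hd', hu', hBv', hCv', hs⟩ :=
    exists_split (mem_inn.2 ⟨(f.toFun v).2, f.isInner v hv⟩)
  obtain ⟨b, hb⟩ := F.nonempty_of_mem B hB
  obtain ⟨c, hc⟩ := F.nonempty_of_mem C hC
  have hbv := hBv.1 hb
  have hYv : Y ⊂ (f.toFun v).1 := by
    rcases comparable_of_mem hY (f.toFun v).2 (hvY hbv) (f.le_map v hbv) with h | h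
    · exact ⟨h, hcon⟩
    · exact absurd h hcon
  have hlt : ∀ D (hD : D ∈ F.verts), D ⊂ v.1 → (f.toFun ⟨D, hD⟩).1 ⊂ (f.toFun v).1 := by
    intro D hD hDv
    refine Finset.ssubset_iff_subset_ne.2 ⟨f.monotone (show (⟨D, hD⟩ : F.Vertex) ≤ v from hDv.1),
      fun h => ?_⟩
    exact (f.injective_tree ⟨D, hD⟩ v ⟨v, hDv.1, le_rfl⟩
      fun h' => hDv.ne (congrArg Subtype.val h')).1 (Subtype.ext h)
  -- The edge leaving `E` would lie on the paths of both `B` and `C`, since every vertex of `F`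
  -- strictly beyond `B` or `C` is at or beyond `v`.
  have key : ∀ E (hE : E ∈ F'.verts), E ⊂ (f.toFun v).1 →
      ¬ ((f.toFun ⟨B, hB⟩).1 ⊆ E ∧ (f.toFun ⟨C, hC⟩).1 ⊆ E) := by
    rintro E hE hEv ⟨h1, h2⟩
    have hne : (⟨B, hB⟩ : F.Vertex) ≠ ⟨C, hC⟩ := fun h =>
      Finset.disjoint_left.1 hd hb ((show B = C from congrArg Subtype.val h).le hb)
    have habove : ∀ D (hD : D ∈ F.verts) (d : I), d ∈ D → (D = B ∨ D = C) →
        (f.toFun ⟨D, hD⟩).1 ⊆ E → (⟨E, hE⟩ : F'.Vertex) ∈ edgePath f.toFun ⟨D, hD⟩ := by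
      intro D hD d hdD hDD hDE
      refine ⟨hDE, fun w hw => ?_⟩
      have hvw : v ≤ w := by
        have hDv : D ⊆ v.1 := by rcases hDD with rfl | rfl; exacts [hBv.1, hCv.1]
        rcases comparable (F := F) (u := ⟨D, hD⟩) (v := v) (w := w) hDv hw.le with h | h
        · exact h
        rcases h.eq_or_lt with h | h
        · exact h.ge
        exfalso
        rcases hDD with rfl | rfl
        · have h1 : D ⊂ w.1 := hw
          have h2 : w.1 ⊂ v.1 := h
          rcases F.laminar w.1 w.2 C hC with h3 | h3 | h3
          · exact Finset.disjoint_left.1 hd hdD (h3 (h1.1 hdD))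
          · exact h2.2 (hu ▸ Finset.union_subset h1.1 h3)
          · refine h1.2 fun x hx => ?_
            exact (Finset.mem_union.1 (hu ▸ h2.1 hx)).resolve_right (Finset.disjoint_left.1 h3 hx)
        · have h1 : D ⊂ w.1 := hw
          have h2 : w.1 ⊂ v.1 := h
          rcases F.laminar w.1 w.2 B hB with h3 | h3 | h3
          · exact Finset.disjoint_left.1 hd (h3 (h1.1 hdD)) hdD
          · exact h2.2 (hu ▸ Finset.union_subset h3 h1.1)
          · refine h1.2 fun x hx => ?_
            exact (Finset.mem_union.1 (hu ▸ h2.1 hx)).resolve_left (Finset.disjoint_left.1 h3 hx)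
      exact lt_of_lt_of_le (show (⟨E, hE⟩ : F'.Vertex) < f.toFun v from hEv) (f.monotone hvw)
    exact Set.disjoint_left.1 (f.injective_tree ⟨B, hB⟩ ⟨C, hC⟩ ⟨v, hBv.1, hCv.1⟩ hne).2
      (habove B hB b hb (Or.inl rfl) h1) (habove C hC c hc (Or.inr rfl) h2)
  have hfB := hlt B hB hBv
  have hfC := hlt C hC hCv
  have hbB : b ∈ (f.toFun ⟨B, hB⟩).1 := f.le_map ⟨B, hB⟩ hb
  have hcC : c ∈ (f.toFun ⟨C, hC⟩).1 := f.le_map ⟨C, hC⟩ hc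
  have hbY : b ∈ Y := hvY (hBv.1 hb)
  have hcY : c ∈ Y := hvY (hCv.1 hc)
  rcases hs Y hY hYv with h | h
  · refine key B' hB' hBv' ⟨(hs _ (f.toFun _).2 hfB).resolve_right fun h' => ?_,
      (hs _ (f.toFun _).2 hfC).resolve_right fun h' => ?_⟩
    · exact Finset.disjoint_left.1 hd' (h hbY) (h' hbB)
    · exact Finset.disjoint_left.1 hd' (h hcY) (h' hcC)
  · refine key C' hC' hCv' ⟨(hs _ (f.toFun _).2 hfB).resolve_left fun h' => ?_,
      (hs _ (f.toFun _).2 hfC).resolve_left fun h' => ?_⟩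
    · exact Finset.disjoint_left.1 hd' (h' hbB) (h hbY)
    · exact Finset.disjoint_left.1 hd' (h' hcC) (h hcY)

/-- The map which sends every vertex to the least vertex above it. -/
theorem exists_map {F F' : BinForest I} (φ : F.Vertex → F'.Vertex)
    (hφ : ∀ v, F'.IsLca v.1 (φ v).1) (hinj : Set.InjOn φ {v | IsInner v}) :
    Nonempty (Map F F') := by
  have hmono : Monotone φ := fun v w h => (hφ v).2.2 _ (φ w).2
    ((show v.1 ⊆ w.1 from h).trans (hφ w).2.1)
  have hinner : ∀ v, IsInner v → IsInner (φ v) := fun v hv =>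
    lt_of_lt_of_le hv (Finset.card_le_card (hφ v).2.1)
  have hleaf : ∀ i, φ (F.leaf i) = F'.leaf i := fun i =>
    Subtype.ext ((hφ (F.leaf i)).unique (isLca_singleton F' i))
  have hinj' : Function.Injective φ := by
    intro v w h
    rcases isInner_or_leaf v with hv | ⟨i, rfl⟩ <;> rcases isInner_or_leaf w with hw | ⟨j, rfl⟩
    · exact hinj hv hw h
    · have := hinner v hv
      rw [h, hleaf] at this
      exact absurd this (not_isInner_leaf F' j)
    · have := hinner w hw
      rw [← h, hleaf] at this
      exact absurd this (not_isInner_leaf F' i)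
    · rw [hleaf, hleaf] at h
      have : i = j := Finset.singleton_injective (congrArg Subtype.val h)
      rw [this]
  refine ⟨⟨φ, hmono, hinner, hinj, hleaf, fun v w ⟨u', hu1, hu2⟩ hne =>
    ⟨fun h => hne (hinj' h), Set.disjoint_left.2 ?_⟩⟩⟩
  rintro x ⟨hvx, hvx'⟩ ⟨hwx, hwx'⟩
  by_cases hvw : v ≤ w
  · exact (hvx' w (lt_of_le_of_ne hvw hne)).not_ge hwx
  by_cases hwv : w ≤ v
  · exact (hwx' v (lt_of_le_of_ne hwv hne.symm)).not_ge hvx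
  -- For incomparable `v`, `w`, let `u` be their least common vertex. A shared edge `x` would lie
  -- strictly inside `φ u` and meet both branches `B`, `C` of `u`. Both branches then have their
  -- images on the side of `x`, so a vertex smaller than `φ u` contains `u`.
  obtain ⟨i, hi⟩ := F.nonempty_of_mem v.1 v.2
  obtain ⟨j, hj⟩ := F.nonempty_of_mem w.1 w.2
  obtain ⟨u, hu, hvwu, humin⟩ := exists_isLca (F := F) (A := v.1 ∪ w.1)
    ⟨i, Finset.mem_union_left _ hi⟩ u'.2 (Finset.union_subset hu1 hu2)
  have hvu : v.1 ⊂ u := ⟨Finset.subset_union_left.trans hvwu, fun h =>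
    hwv ((Finset.subset_union_right.trans hvwu).trans h)⟩
  have hwu : w.1 ⊂ u := ⟨Finset.subset_union_right.trans hvwu, fun h =>
    hvw ((Finset.subset_union_left.trans hvwu).trans h)⟩
  have huI : u ∈ F.inn := by
    rcases mem_inn_or_singleton hu with h | ⟨k, rfl⟩
    · exact h
    · rw [Finset.ssubset_singleton_iff] at hvu
      exact absurd hvu (Finset.ne_empty_of_mem hi)
  have hxu : x.1 ⊂ (φ ⟨u, hu⟩).1 := hvx' ⟨u, hu⟩ hvu
  obtain ⟨B, hB, C, hC, hd, hBC, hBu, hCu, hs⟩ := exists_split huI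
  have hlt : ∀ D (hD : D ∈ F.verts), D ⊂ u → (φ ⟨D, hD⟩).1 ⊂ (φ ⟨u, hu⟩).1 := by
    intro D hD hDu
    refine Finset.ssubset_iff_subset_ne.2 ⟨hmono (show (⟨D, hD⟩ : F.Vertex) ≤ ⟨u, hu⟩ from hDu.1),
      fun h => ?_⟩
    exact hDu.ne (congrArg Subtype.val (hinj' (Subtype.ext h)))
  obtain ⟨B', hB', C', hC', hd', hu', hBv', hCv', hs'⟩ :=
    exists_split (mem_inn.2 ⟨(φ ⟨u, hu⟩).2, hinner _ (mem_inn.1 huI).2⟩)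
  have hcon : ∀ E ∈ F'.verts, E ⊂ (φ ⟨u, hu⟩).1 → ¬ (B ⊆ E ∧ C ⊆ E) := fun E hE hEu h =>
    hEu.2 ((hφ ⟨u, hu⟩).2.2 E hE (hBC ▸ Finset.union_subset h.1 h.2))
  have hix : i ∈ x.1 := hvx ((hφ v).2.1 hi)
  have hjx : j ∈ x.1 := hwx ((hφ w).2.1 hj)
  have hcross : (∃ k ∈ B, k ∈ x.1) ∧ ∃ k ∈ C, k ∈ x.1 := by
    rcases hs v.1 v.2 hvu with h1 | h1 <;> rcases hs w.1 w.2 hwu with h2 | h2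
    · exact absurd (humin B hB (Finset.union_subset h1 h2)) hBu.2
    · exact ⟨⟨i, h1 hi, hix⟩, j, h2 hj, hjx⟩
    · exact ⟨⟨j, h2 hj, hjx⟩, i, h1 hi, hix⟩
    · exact absurd (humin C hC (Finset.union_subset h1 h2)) hCu.2
  obtain ⟨⟨b, hb, hbx⟩, c, hc, hcx⟩ := hcross
  have hφB := (hφ ⟨B, hB⟩).2.1
  have hφC := (hφ ⟨C, hC⟩).2.1
  rcases hs' x.1 x.2 hxu with h | h
  · refine hcon B' hB' hBv' ⟨hφB.trans ((hs' _ (φ _).2 (hlt B hB hBu)).resolve_right fun h' => ?_),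
      hφC.trans ((hs' _ (φ _).2 (hlt C hC hCu)).resolve_right fun h' => ?_)⟩
    · exact Finset.disjoint_left.1 hd' (h hbx) (h' (hφB hb))
    · exact Finset.disjoint_left.1 hd' (h hcx) (h' (hφC hc))
  · refine hcon C' hC' hCv' ⟨hφB.trans ((hs' _ (φ _).2 (hlt B hB hBu)).resolve_left fun h' => ?_),
      hφC.trans ((hs' _ (φ _).2 (hlt C hC hCu)).resolve_left fun h' => ?_)⟩
    · exact Finset.disjoint_left.1 hd' (h' (hφB hb)) (h hbx)
    · exact Finset.disjoint_left.1 hd' (h' (hφC hc)) (h hcx)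

/-- `F ≤ F'` if and only if every vertex of `F` lies above a vertex of `F'` and distinct inner
vertices of `F` have distinct least vertices of `F'` below them. -/
theorem le_iff {F F' : BinForest I} : F ≤ F' ↔ (∀ A ∈ F.inn, ∃ X ∈ F'.verts, A ⊆ X) ∧
    ∀ A ∈ F.inn, ∀ A' ∈ F.inn, ∀ X, F'.IsLca A X → F'.IsLca A' X → A = A' := by
  constructor
  · rintro ⟨f⟩
    refine ⟨fun A hA => ⟨_, (f.toFun ⟨A, (mem_inn.1 hA).1⟩).2, f.le_map ⟨A, (mem_inn.1 hA).1⟩⟩,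
      fun A hA A' hA' X h h' => ?_⟩
    have h1 := h.unique (f.isLca ⟨A, (mem_inn.1 hA).1⟩)
    have h2 := h'.unique (f.isLca ⟨A', (mem_inn.1 hA').1⟩)
    exact congrArg Subtype.val (f.injOn_inner (mem_inn.1 hA).2 (mem_inn.1 hA').2
      (Subtype.ext (h1.symm.trans h2)))
  · rintro ⟨h1, h2⟩
    have h3 : ∀ v : F.Vertex, ∃ X : F'.Vertex, F'.IsLca v.1 X.1 := by
      intro v
      rcases mem_inn_or_singleton v.2 with hv | ⟨i, hi⟩
      · obtain ⟨X, hX, hvX⟩ := h1 v.1 hv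
        obtain ⟨Y, hY⟩ := exists_isLca (F.nonempty_of_mem v.1 v.2) hX hvX
        exact ⟨⟨Y, hY.1⟩, hY⟩
      · exact ⟨F'.leaf i, hi ▸ isLca_singleton F' i⟩
    choose φ hφ using h3
    exact exists_map φ hφ fun v hv w hw h => Subtype.ext
      (h2 v.1 (mem_inn.2 ⟨v.2, hv⟩) w.1 (mem_inn.2 ⟨w.2, hw⟩) _ (hφ v) (h ▸ hφ w))

/-! ### Joining two trees -/

/-- `T` is the lowest vertex of a tree of `F`. -/
def IsRoot (F : BinForest I) (T : Finset I) : Prop :=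
  T ∈ F.verts ∧ ∀ B ∈ F.verts, T ⊆ B → B = T

theorem IsRoot.subset_or_disjoint {F : BinForest I} {T A : Finset I} (hT : F.IsRoot T)
    (hA : A ∈ F.verts) : A ⊆ T ∨ Disjoint A T := by
  rcases F.laminar A hA T hT.1 with h | h | h
  · exact Or.inl h
  · exact Or.inl (hT.2 A hA h).le
  · exact Or.inr h

theorem IsRoot.subset {F : BinForest I} {T A : Finset I} (hT : F.IsRoot T)
    (hA : A ∈ F.verts) {i : I} (hi : i ∈ A) (hi' : i ∈ T) : A ⊆ T :=
  (hT.subset_or_disjoint hA).resolve_right fun h => Finset.disjoint_left.1 h hi hi'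

theorem IsRoot.eq {F : BinForest I} {T S : Finset I} (hT : F.IsRoot T)
    (hS : F.IsRoot S) {i : I} (hi : i ∈ T) (hi' : i ∈ S) : T = S :=
  (hT.subset hS.1 hi' hi).antisymm' (hS.subset hT.1 hi hi')

theorem IsRoot.disjoint {F : BinForest I} {T S : Finset I} (hT : F.IsRoot T)
    (hS : F.IsRoot S) (hne : T ≠ S) : Disjoint T S :=
  Finset.disjoint_left.2 fun _ hi hi' => hne (hT.eq hS hi hi')

theorem exists_isRoot {F : BinForest I} {A : Finset I} (hA : A ∈ F.verts) :
    ∃ T, F.IsRoot T ∧ A ⊆ T := by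
  obtain ⟨T, hT, hmax⟩ := Finset.exists_max_image (F.verts.filter fun T => A ⊆ T) Finset.card
    ⟨A, by simp [hA]⟩
  simp only [Finset.mem_filter] at hT hmax
  exact ⟨T, ⟨hT.1, fun B hB h => (Finset.eq_of_subset_of_card_le h
    (hmax B ⟨hB, hT.2.trans h⟩)).symm⟩, hT.2⟩

/-- `G` is obtained from `H` by grafting its trees `T₁` and `T₂` at a new vertex. -/
structure IsJoin (G H : BinForest I) (T₁ T₂ : Finset I) : Prop where
  root₁ : H.IsRoot T₁
  root₂ : H.IsRoot T₂
  ne : T₁ ≠ T₂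
  verts_eq : G.verts = insert (T₁ ∪ T₂) H.verts

namespace IsJoin

variable {F F' G H : BinForest I} {T₁ T₂ S₁ S₂ A X : Finset I}

theorem disjoint (h : IsJoin G H T₁ T₂) : Disjoint T₁ T₂ := h.root₁.disjoint h.root₂ h.ne

theorem symm (h : IsJoin G H T₁ T₂) : IsJoin G H T₂ T₁ :=
  ⟨h.root₂, h.root₁, h.ne.symm, by rw [Finset.union_comm, h.verts_eq]⟩

theorem mem_iff (h : IsJoin G H T₁ T₂) : A ∈ G.verts ↔ A = T₁ ∪ T₂ ∨ A ∈ H.verts := by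
  rw [h.verts_eq, Finset.mem_insert]

theorem mem (h : IsJoin G H T₁ T₂) (hA : A ∈ H.verts) : A ∈ G.verts := h.mem_iff.2 (Or.inr hA)

theorem union_mem (h : IsJoin G H T₁ T₂) : T₁ ∪ T₂ ∈ G.verts := h.mem_iff.2 (Or.inl rfl)

theorem not_union_subset (h : IsJoin G H T₁ T₂) (hA : A ∈ H.verts) : ¬ T₁ ∪ T₂ ⊆ A := by
  intro hs
  have h1 := h.root₁.2 A hA (Finset.subset_union_left.trans hs)
  have h2 := h.root₂.2 A hA (Finset.subset_union_right.trans hs)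
  exact h.ne (h1.symm.trans h2)

theorem union_notMem (h : IsJoin G H T₁ T₂) : T₁ ∪ T₂ ∉ H.verts := fun h' =>
  h.not_union_subset h' subset_rfl

theorem isRoot (h : IsJoin G H T₁ T₂) : G.IsRoot (T₁ ∪ T₂) :=
  ⟨h.union_mem, fun _ hB hs => (h.mem_iff.1 hB).resolve_right fun hB' => h.not_union_subset hB' hs⟩

theorem one_lt_card (h : IsJoin G H T₁ T₂) : 1 < (T₁ ∪ T₂).card := by
  rw [Finset.card_union_of_disjoint h.disjoint]
  have h1 := Finset.card_pos.2 (H.nonempty_of_mem _ h.root₁.1)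
  have h2 := Finset.card_pos.2 (H.nonempty_of_mem _ h.root₂.1)
  omega

theorem inn_eq (h : IsJoin G H T₁ T₂) : G.inn = insert (T₁ ∪ T₂) H.inn := by
  rw [inn, h.verts_eq, Finset.filter_insert, if_pos h.one_lt_card, inn]

theorem union_notMem_inn (h : IsJoin G H T₁ T₂) : T₁ ∪ T₂ ∉ H.inn := fun h' =>
  h.union_notMem (mem_inn.1 h').1

theorem mem_inn_iff (h : IsJoin G H T₁ T₂) : A ∈ G.inn ↔ A = T₁ ∪ T₂ ∨ A ∈ H.inn := by
  rw [h.inn_eq, Finset.mem_insert]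

theorem card_inn (h : IsJoin G H T₁ T₂) : G.inn.card = H.inn.card + 1 := by
  rw [h.inn_eq, Finset.card_insert_of_notMem h.union_notMem_inn]

theorem eq_of_eq (h : IsJoin G H T₁ T₂) (h' : IsJoin F H T₁ T₂) : G = F :=
  BinForest.ext (h.verts_eq.trans h'.verts_eq.symm)

theorem subset_or (h : IsJoin G H T₁ T₂) (hA : A ∈ H.verts) (hs : A ⊆ T₁ ∪ T₂) :
    A ⊆ T₁ ∨ A ⊆ T₂ := by
  rcases h.root₁.subset_or_disjoint hA with h1 | h1
  · exact Or.inl h1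
  · exact Or.inr fun x hx => (Finset.mem_union.1 (hs hx)).resolve_left
      (Finset.disjoint_left.1 h1 hx)

/-- The new vertex is a root, so it contains every vertex it meets and cannot undercut an old least
vertex. -/
theorem isLca_of_isLca (h : IsJoin G H T₁ T₂) (hA : A.Nonempty) (hX : H.IsLca A X) :
    G.IsLca A X := by
  refine ⟨h.mem hX.1, hX.2.1, fun Y hY hAY => ?_⟩
  rcases h.mem_iff.1 hY with rfl | hY
  · obtain ⟨i, hi⟩ := hA
    exact h.isRoot.subset (h.mem hX.1) (hX.2.1 hi) (hAY hi)
  · exact hX.2.2 Y hY hAY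

theorem isLca_of_mem (h : IsJoin G H T₁ T₂) (hX : G.IsLca A X) (hX' : X ∈ H.verts) :
    H.IsLca A X :=
  ⟨hX', hX.2.1, fun Y hY => hX.2.2 Y (h.mem hY)⟩

theorem le (h : IsJoin G H T₁ T₂) : H ≤ G := by
  refine le_iff.2 ⟨fun A hA => ⟨A, h.mem (mem_inn.1 hA).1, subset_rfl⟩,
    fun A hA A' hA' X hX hX' => ?_⟩
  have hA := (mem_inn.1 hA).1
  have hA' := (mem_inn.1 hA').1
  have h1 := hX.unique ⟨h.mem hA, subset_rfl, fun _ _ h => h⟩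
  have h2 := hX'.unique ⟨h.mem hA', subset_rfl, fun _ _ h => h⟩
  exact h1.symm.trans h2

/-- The lca of a union which meets both trees is the new vertex. -/
theorem isLca_union (h : IsJoin G H T₁ T₂) (h1 : S₁ ⊆ T₁) (h2 : S₂ ⊆ T₂) (hS₁ : S₁.Nonempty)
    (hS₂ : S₂.Nonempty) : G.IsLca (S₁ ∪ S₂) (T₁ ∪ T₂) := by
  refine ⟨h.union_mem, Finset.union_subset_union h1 h2, fun Y hY hs => ?_⟩
  rcases h.mem_iff.1 hY with rfl | hY
  · exact subset_rfl
  obtain ⟨i, hi⟩ := hS₁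
  obtain ⟨j, hj⟩ := hS₂
  have hi1 := hs (Finset.mem_union_left _ hi)
  have hj1 := hs (Finset.mem_union_right _ hj)
  exact absurd (h.root₁.subset hY hi1 (h1 hi) hj1)
    fun h' => Finset.disjoint_left.1 h.disjoint h' (h2 hj)

end IsJoin

/-- Grafting two trees at a new vertex. -/
def join (G : BinForest I) {T₁ T₂ : Finset I} (h₁ : G.IsRoot T₁) (h₂ : G.IsRoot T₂)
    (hne : T₁ ≠ T₂) : BinForest I where
  verts := insert (T₁ ∪ T₂) G.verts
  nonempty_of_mem A hA := by
    rcases Finset.mem_insert.1 hA with rfl | hA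
    · exact (G.nonempty_of_mem _ h₁.1).mono Finset.subset_union_left
    · exact G.nonempty_of_mem A hA
  singleton_mem i := Finset.mem_insert_of_mem (G.singleton_mem i)
  laminar := by
    have key : ∀ A ∈ G.verts, A ⊆ T₁ ∪ T₂ ∨ Disjoint A (T₁ ∪ T₂) := by
      intro A hA
      rcases h₁.subset_or_disjoint hA with h | h
      · exact Or.inl (h.trans Finset.subset_union_left)
      rcases h₂.subset_or_disjoint hA with h' | h'
      · exact Or.inl (h'.trans Finset.subset_union_right)
      · exact Or.inr (Finset.disjoint_union_right.2 ⟨h, h'⟩)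
    intro A hA B hB
    rcases Finset.mem_insert.1 hA with rfl | hA <;> rcases Finset.mem_insert.1 hB with rfl | hB
    · exact Or.inl subset_rfl
    · rcases key B hB with h | h
      · exact Or.inr (Or.inl h)
      · exact Or.inr (Or.inr h.symm)
    · rcases key A hA with h | h
      · exact Or.inl h
      · exact Or.inr (Or.inr h)
    · exact G.laminar A hA B hB
  binary A hA hc := by
    rcases Finset.mem_insert.1 hA with rfl | hA
    · exact ⟨T₁, Finset.mem_insert_of_mem h₁.1, T₂, Finset.mem_insert_of_mem h₂.1,
        h₁.disjoint h₂ hne, rfl⟩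
    · obtain ⟨B, hB, C, hC, h⟩ := G.binary A hA hc
      exact ⟨B, Finset.mem_insert_of_mem hB, C, Finset.mem_insert_of_mem hC, h⟩

theorem isJoin_join (G : BinForest I) {T₁ T₂ : Finset I} (h₁ : G.IsRoot T₁) (h₂ : G.IsRoot T₂)
    (hne : T₁ ≠ T₂) : IsJoin (G.join h₁ h₂ hne) G T₁ T₂ :=
  ⟨h₁, h₂, hne, rfl⟩

/-- Every inner vertex which is the lowest vertex of a tree can be removed. -/
theorem exists_isJoin_of_isRoot {G : BinForest I} {A : Finset I} (hA : G.IsRoot A)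
    (hc : 1 < A.card) : ∃ H T₁ T₂, IsJoin G H T₁ T₂ ∧ T₁ ∪ T₂ = A := by
  obtain ⟨T₁, h₁, T₂, h₂, hd, hu, hs₁, hs₂, hs⟩ := exists_split (mem_inn.2 ⟨hA.1, hc⟩)
  have hnot : ∀ B ∈ G.verts, ∀ D, D ⊂ B → D ≠ A := by
    rintro B hB D hDB rfl
    exact hDB.2 (hA.2 B hB hDB.1).le
  let H : BinForest I :=
    { verts := G.verts.erase A
      nonempty_of_mem := fun B hB => G.nonempty_of_mem B (Finset.mem_of_mem_erase hB)
      singleton_mem := fun i => Finset.mem_erase.2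
        ⟨fun h => by rw [← h, Finset.card_singleton] at hc; exact lt_irrefl _ hc,
          G.singleton_mem i⟩
      laminar := fun B hB C hC =>
        G.laminar B (Finset.mem_of_mem_erase hB) C (Finset.mem_of_mem_erase hC)
      binary := fun B hB hBc => by
        have hB := Finset.mem_of_mem_erase hB
        obtain ⟨C, hC, D, hD, hd, hu, hsC, hsD, -⟩ := exists_split (mem_inn.2 ⟨hB, hBc⟩)
        exact ⟨C, Finset.mem_erase.2 ⟨hnot B hB C hsC, hC⟩, D,
          Finset.mem_erase.2 ⟨hnot B hB D hsD, hD⟩, hd, hu⟩ }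
  have hroot : ∀ T ∈ G.verts, T ⊂ A → (∀ D ∈ G.verts, D ⊂ A → T ⊆ D → D ⊆ T) → H.IsRoot T := by
    intro T hT hTA hmax
    refine ⟨Finset.mem_erase.2 ⟨hTA.ne, hT⟩, fun B hB hTB => ?_⟩
    obtain ⟨hBA, hB⟩ := Finset.mem_erase.1 hB
    obtain ⟨i, hi⟩ := G.nonempty_of_mem T hT
    have hBA' := hA.subset hB (hTB hi) (hTA.1 hi)
    exact (hmax B hB (Finset.ssubset_iff_subset_ne.2 ⟨hBA', hBA⟩) hTB).antisymm hTB
  obtain ⟨i, hi⟩ := G.nonempty_of_mem T₁ h₁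
  obtain ⟨j, hj⟩ := G.nonempty_of_mem T₂ h₂
  refine ⟨H, T₁, T₂, ⟨hroot T₁ h₁ hs₁ fun D hD hDA hTD => ?_,
    hroot T₂ h₂ hs₂ fun D hD hDA hTD => ?_,
    ?_, ?_⟩, hu⟩
  · exact (hs D hD hDA).resolve_right fun h => Finset.disjoint_left.1 hd hi (h (hTD hi))
  · exact (hs D hD hDA).resolve_left fun h => Finset.disjoint_left.1 hd (h (hTD hj)) hj
  · rintro rfl
    exact Finset.disjoint_left.1 hd hi hi
  · rw [hu]
    exact (Finset.insert_erase hA.1).symm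

theorem exists_isJoin {G : BinForest I} (hG : G.inn.Nonempty) : ∃ H T₁ T₂, IsJoin G H T₁ T₂ := by
  obtain ⟨A, hA⟩ := hG
  obtain ⟨T, hT, hAT⟩ := exists_isRoot (mem_inn.1 hA).1
  obtain ⟨H, T₁, T₂, h, -⟩ := exists_isJoin_of_isRoot hT
    ((mem_inn.1 hA).2.trans_le (Finset.card_le_card hAT))
  exact ⟨H, T₁, T₂, h⟩

/-- The forests below a join. -/
theorem IsJoin.le_iff {F F' G : BinForest I} {U₁ U₂ : Finset I} (h : IsJoin F' F U₁ U₂) :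
    G ≤ F' ↔ G ≤ F ∨ ∃ H T₁ T₂, IsJoin G H T₁ T₂ ∧ T₁ ⊆ U₁ ∧ T₂ ⊆ U₂ ∧ H ≤ F := by
  constructor
  · intro hG
    obtain ⟨hex, hinj⟩ := BinForest.le_iff.1 hG
    have hlca : ∀ A ∈ G.verts, ∃ X, F'.IsLca A X := by
      intro A hA
      rcases mem_inn_or_singleton hA with hA' | ⟨i, rfl⟩
      · obtain ⟨X, hX, hAX⟩ := hex A hA'
        exact exists_isLca (G.nonempty_of_mem A hA) hX hAX
      · exact ⟨_, isLca_singleton F' i⟩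
    -- The dichotomy is whether some inner vertex of `G` is sent to the new vertex of `F'`.
    by_cases hA : ∃ A ∈ G.inn, F'.IsLca A (U₁ ∪ U₂)
    · right
      obtain ⟨A, hA, hAU⟩ := hA
      -- Any larger vertex would also be sent to the root `U₁ ∪ U₂`, so injectivity makes it equal
      -- to `A`.
      have hroot : G.IsRoot A := by
        refine ⟨(mem_inn.1 hA).1, fun B hB hAB => ?_⟩
        have hB' : B ∈ G.inn :=
          mem_inn.2 ⟨hB, (mem_inn.1 hA).2.trans_le (Finset.card_le_card hAB)⟩
        obtain ⟨X, hX⟩ := hlca B hB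
        have hX' : X = U₁ ∪ U₂ := h.isRoot.2 X hX.1 (hAU.2.2 X hX.1 (hAB.trans hX.2.1))
        exact hinj B hB' A hA _ (hX' ▸ hX) hAU
      obtain ⟨H, T₁, T₂, hj, rfl⟩ := exists_isJoin_of_isRoot hroot (mem_inn.1 hA).2
      have hH : H ≤ F := by
        refine BinForest.le_iff.2 ⟨fun B hB => ?_, fun B hB B' hB' X hX hX' => ?_⟩
        · have hB' := hj.mem_inn_iff.2 (Or.inr hB)
          obtain ⟨X, hX⟩ := hlca B (mem_inn.1 hB').1
          refine ⟨X, (h.mem_iff.1 hX.1).resolve_left ?_, hX.2.1⟩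
          rintro rfl
          have := hinj B hB' _ hA _ hX hAU
          exact hj.union_notMem_inn (this ▸ hB)
        · exact hinj B (hj.mem_inn_iff.2 (Or.inr hB)) B' (hj.mem_inn_iff.2 (Or.inr hB')) X
            (h.isLca_of_isLca (H.nonempty_of_mem _ (mem_inn.1 hB).1) hX)
            (h.isLca_of_isLca (H.nonempty_of_mem _ (mem_inn.1 hB').1) hX')
      -- Each of the two trees of `H` lies in a single tree of `F`, hence on one side. They cannot
      -- share a side, because `U₁ ∪ U₂` is the least vertex containing their union.
      have hside : ∀ T, H.IsRoot T → T ⊆ T₁ ∪ T₂ → T ⊆ U₁ ∨ T ⊆ U₂ := by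
        intro T hT hTT
        have : ∃ X ∈ F.verts, T ⊆ X := by
          rcases mem_inn_or_singleton hT.1 with h' | ⟨i, rfl⟩
          · exact (BinForest.le_iff.1 hH).1 T h'
          · exact ⟨{i}, F.singleton_mem i, subset_rfl⟩
        obtain ⟨X, hX, hTX⟩ := this
        obtain ⟨i, hi⟩ := H.nonempty_of_mem T hT.1
        have hXU := h.isRoot.subset (h.mem hX) (hTX hi) (hAU.2.1 (hTT hi))
        exact (h.subset_or hX hXU).imp hTX.trans hTX.trans
      have hnot : ∀ U ∈ F.verts, ¬ (T₁ ⊆ U ∧ T₂ ⊆ U) := fun U hU hs =>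
        h.not_union_subset hU (hAU.2.2 U (h.mem hU) (Finset.union_subset hs.1 hs.2))
      rcases hside T₁ hj.root₁ Finset.subset_union_left with h1 | h1 <;>
        rcases hside T₂ hj.root₂ Finset.subset_union_right with h2 | h2
      · exact absurd ⟨h1, h2⟩ (hnot _ h.root₁.1)
      · exact ⟨H, T₁, T₂, hj, h1, h2, hH⟩
      · exact ⟨H, T₂, T₁, hj.symm, h2, h1, hH⟩
      · exact absurd ⟨h1, h2⟩ (hnot _ h.root₂.1)
    · left
      refine BinForest.le_iff.2 ⟨fun A hA' => ?_, fun A hA A' hA' X hX hX' => ?_⟩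
      · obtain ⟨X, hX⟩ := hlca A (mem_inn.1 hA').1
        refine ⟨X, (h.mem_iff.1 hX.1).resolve_left ?_, hX.2.1⟩
        rintro rfl
        exact hA ⟨A, hA', hX⟩
      · exact hinj A hA A' hA' X
          (h.isLca_of_isLca (G.nonempty_of_mem _ (mem_inn.1 hA).1) hX)
          (h.isLca_of_isLca (G.nonempty_of_mem _ (mem_inn.1 hA').1) hX')
  · rintro (hG | ⟨H, T₁, T₂, hj, h1, h2, hH⟩)
    · exact hG.trans h.le
    obtain ⟨hex, hinj⟩ := BinForest.le_iff.1 hH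
    have hT := h.isLca_union h1 h2 (H.nonempty_of_mem _ hj.root₁.1) (H.nonempty_of_mem _ hj.root₂.1)
    -- Since `H ≤ F`, the least vertex of `F'` is already a vertex of `F`, so it cannot collide with
    -- the image of the new vertex of `G`.
    have hlca : ∀ A ∈ H.inn, ∀ X, F'.IsLca A X → F.IsLca A X := by
      intro A hA X hX
      obtain ⟨Y, hY, hAY⟩ := hex A hA
      have hne := H.nonempty_of_mem A (mem_inn.1 hA).1
      obtain ⟨Z, hZ⟩ := exists_isLca hne hY hAY
      rwa [hX.unique (h.isLca_of_isLca hne hZ)]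
    refine BinForest.le_iff.2 ⟨fun A hA => ?_, fun A hA A' hA' X hX hX' => ?_⟩
    · rcases hj.mem_inn_iff.1 hA with rfl | hA
      · exact ⟨_, hT.1, hT.2.1⟩
      · obtain ⟨Y, hY, hAY⟩ := hex A hA
        exact ⟨Y, h.mem hY, hAY⟩
    · rcases hj.mem_inn_iff.1 hA with rfl | hA <;> rcases hj.mem_inn_iff.1 hA' with rfl | hA'
      · rfl
      · have := (hlca A' hA' X hX').1
        rw [hX.unique hT] at this
        exact absurd this h.union_notMem
      · have := (hlca A hA X hX).1
        rw [hX'.unique hT] at this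
        exact absurd this h.union_notMem
      · exact hinj A hA A' hA' X (hlca A hA X hX) (hlca A' hA' X hX')

/-- `T₁ ∪ T₂` meets both `U₁` and `U₂`, and no vertex of `F` does. -/
theorem IsJoin.not_le {F F' G H : BinForest I} {U₁ U₂ T₁ T₂ : Finset I} (h : IsJoin F' F U₁ U₂)
    (hj : IsJoin G H T₁ T₂) (h₁ : T₁ ⊆ U₁) (h₂ : T₂ ⊆ U₂) : ¬ G ≤ F := by
  intro hle
  obtain ⟨X, hX, hs⟩ := (BinForest.le_iff.1 hle).1 (T₁ ∪ T₂) (hj.mem_inn_iff.2 (Or.inl rfl))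
  have hT := h.isLca_union h₁ h₂ (H.nonempty_of_mem _ hj.root₁.1)
    (H.nonempty_of_mem _ hj.root₂.1)
  exact h.not_union_subset hX (hT.2.2 X (h.mem hX) hs)

/-- The new vertex of `G` is the one meeting both `U₁` and `U₂`. Intersecting it with these sets
recovers the two trees, and erasing it recovers the smaller forest. -/
theorem IsJoin.unique {F F' G H H' : BinForest I} {U₁ U₂ T₁ T₂ S₁ S₂ : Finset I}
    (h : IsJoin F' F U₁ U₂) (hj : IsJoin G H T₁ T₂) (h₁ : T₁ ⊆ U₁) (h₂ : T₂ ⊆ U₂)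
    (hH : H' ≤ F) (hj' : IsJoin G H' S₁ S₂) (h₁' : S₁ ⊆ U₁) (h₂' : S₂ ⊆ U₂) :
    H = H' ∧ T₁ = S₁ ∧ T₂ = S₂ := by
  have heq : T₁ ∪ T₂ = S₁ ∪ S₂ := by
    refine (hj'.mem_iff.1 hj.union_mem).resolve_right fun hmem => ?_
    obtain ⟨X, hX, hs⟩ := (BinForest.le_iff.1 hH).1 _ (mem_inn.2 ⟨hmem, hj.one_lt_card⟩)
    have hT := h.isLca_union h₁ h₂ (H.nonempty_of_mem _ hj.root₁.1)
      (H.nonempty_of_mem _ hj.root₂.1)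
    exact h.not_union_subset hX (hT.2.2 X (h.mem hX) hs)
  have key : ∀ {P Q : Finset I}, P ⊆ U₁ → Q ⊆ U₂ → (P ∪ Q) ∩ U₁ = P ∧ (P ∪ Q) ∩ U₂ = Q := by
    intro P Q hP hQ
    have hd := Finset.disjoint_left.1 h.disjoint
    constructor <;> ext x <;> simp only [Finset.mem_inter, Finset.mem_union]
    · exact ⟨fun hx => hx.1.resolve_right fun hx' => hd hx.2 (hQ hx'), fun hx => ⟨Or.inl hx, hP hx⟩⟩
    · exact ⟨fun hx => hx.1.resolve_left fun hx' => hd (hP hx') hx.2, fun hx => ⟨Or.inr hx, hQ hx⟩⟩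
  have e₁ := key h₁ h₂
  have e₂ := key h₁' h₂'
  rw [heq] at e₁
  refine ⟨BinForest.ext ?_, e₁.1.symm.trans e₂.1, e₁.2.symm.trans e₂.2⟩
  have e₃ := congrArg (fun s => s.erase (T₁ ∪ T₂)) (hj.verts_eq.symm.trans hj'.verts_eq)
  rwa [Finset.erase_insert hj.union_notMem, heq, Finset.erase_insert hj'.union_notMem] at e₃

/-! ### Induction on a pair of comparable forests -/

theorem exists_superset_of_le {F F' : BinForest I} (h : F ≤ F') {A : Finset I} (hA : A ∈ F.verts) :
    ∃ X ∈ F'.verts, A ⊆ X := by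
  rcases mem_inn_or_singleton hA with hA | ⟨i, rfl⟩
  · exact (le_iff.1 h).1 A hA
  · exact ⟨{i}, F'.singleton_mem i, subset_rfl⟩

theorem IsRoot.subset_of_le {F F' : BinForest I} {A U : Finset I} (hU : F'.IsRoot U) (h : F ≤ F')
    (hA : A ∈ F.verts) {i : I} (hi : i ∈ A) (hi' : i ∈ U) : A ⊆ U := by
  obtain ⟨X, hX, hAX⟩ := exists_superset_of_le h hA
  exact hAX.trans (hU.subset hX (hAX hi) hi')

theorem eq_of_le_of_inn_eq_empty {F F' : BinForest I} (h : F ≤ F') (h' : F'.inn = ∅) : F = F' := by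
  have h0 : F.inn = ∅ := by
    refine Finset.eq_empty_of_forall_notMem fun A hA => ?_
    obtain ⟨X, hX, hAX⟩ := exists_superset_of_le h (mem_inn.1 hA).1
    exact Finset.notMem_empty X
      (h' ▸ mem_inn.2 ⟨hX, (mem_inn.1 hA).2.trans_le (Finset.card_le_card hAX)⟩)
  have key : ∀ G H : BinForest I, G.inn = ∅ → G.verts ⊆ H.verts := by
    intro G H hG A hA
    rcases mem_inn_or_singleton hA with hA | ⟨i, rfl⟩
    · rw [hG] at hA
      exact absurd hA (Finset.notMem_empty A)
    · exact H.singleton_mem i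
  exact BinForest.ext ((key _ _ h0).antisymm (key _ _ h'))

@[elab_as_elim]
theorem join_induction {motive : BinForest I → Prop} (base : ∀ F, F.inn = ∅ → motive F)
    (step : ∀ F' F U₁ U₂, IsJoin F' F U₁ U₂ → motive F → motive F') (F : BinForest I) :
    motive F := by
  induction hn : F.inn.card generalizing F with
  | zero => exact base F (Finset.card_eq_zero.1 hn)
  | succ n ih =>
    obtain ⟨H, U₁, U₂, h⟩ := exists_isJoin (Finset.card_pos.1 (by omega : 0 < F.inn.card))
    exact step F H U₁ U₂ h (ih H (by have := h.card_inn; omega))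

/-- Induction on a pair `F ≤ F'`: a vertex of `F'` is removed, together with the inner vertex
of `F` that is mapped to it, if there is one. -/
@[elab_as_elim]
theorem le_induction {motive : ∀ F F' : BinForest I, F ≤ F' → Prop}
    (base : ∀ F, F.inn = ∅ → motive F F le_rfl)
    (unmarked : ∀ F F' F₁ U₁ U₂ (hj : IsJoin F' F₁ U₁ U₂) (h : F ≤ F₁), motive F F₁ h →
      motive F F' (h.trans hj.le))
    (marked : ∀ F F₀ F' F₁ A₁ A₂ U₁ U₂ (hj : IsJoin F' F₁ U₁ U₂) (hj' : IsJoin F F₀ A₁ A₂)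
      (h₁ : A₁ ⊆ U₁) (h₂ : A₂ ⊆ U₂) (h : F₀ ≤ F₁), motive F₀ F₁ h →
      motive F F' (hj.le_iff.2 (Or.inr ⟨F₀, A₁, A₂, hj', h₁, h₂, h⟩)))
    {F F' : BinForest I} (h : F ≤ F') : motive F F' h := by
  induction F' using join_induction generalizing F with
  | base F' h' =>
    obtain rfl := eq_of_le_of_inn_eq_empty h h'
    exact base F h'
  | step F' F₁ U₁ U₂ hj ih =>
    rcases hj.le_iff.1 h with h' | ⟨F₀, A₁, A₂, hj', h₁, h₂, h'⟩
    · exact unmarked F F' F₁ U₁ U₂ hj h' (ih h')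
    · exact marked F F₀ F' F₁ A₁ A₂ U₁ U₂ hj hj' h₁ h₂ h' (ih h')

/-! ### Inner vertices as a rank function; forests between two given ones -/

theorem IsJoin.eq_of_subset {F F' F₁ : BinForest I} {A₁ A₂ U₁ U₂ : Finset I}
    (h : IsJoin F' F₁ U₁ U₂) (hj : IsJoin F F₁ A₁ A₂) (h₁ : A₁ ⊆ U₁) (h₂ : A₂ ⊆ U₂) : F = F' := by
  obtain rfl := hj.root₁.2 U₁ h.root₁.1 h₁
  obtain rfl := hj.root₂.2 U₂ h.root₂.1 h₂
  exact hj.eq_of_eq h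

/-- The two claims are proved together: the inequality excludes equality in the unmarked step, and
the equality case propagates through the marked one. -/
theorem card_inn_le_and_eq {F F' : BinForest I} (h : F ≤ F') :
    F.inn.card ≤ F'.inn.card ∧ (F.inn.card = F'.inn.card → F = F') := by
  induction h using le_induction with
  | base F h => exact ⟨le_rfl, fun _ => rfl⟩
  | unmarked F F' F₁ U₁ U₂ hj h ih =>
    have := hj.card_inn
    exact ⟨by omega, fun h => by omega⟩
  | marked F F₀ F' F₁ A₁ A₂ U₁ U₂ hj hj' h₁ h₂ h ih =>
    have e := hj.card_inn
    have e' := hj'.card_inn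
    refine ⟨by omega, fun he => ?_⟩
    obtain rfl := ih.2 (by omega)
    exact hj.eq_of_subset hj' h₁ h₂

theorem card_inn_le {F F' : BinForest I} (h : F ≤ F') : F.inn.card ≤ F'.inn.card :=
  (card_inn_le_and_eq h).1

theorem card_inn_lt {F F' : BinForest I} (h : F < F') : F.inn.card < F'.inn.card :=
  lt_of_le_of_ne (card_inn_le h.le) fun he => h.ne ((card_inn_le_and_eq h.le).2 he)

theorem exists_isRoot_between {F G F' : BinForest I} (h : F ≤ G) (h' : G ≤ F') {A U : Finset I}
    (hA : A ∈ F.verts) (hU : F'.IsRoot U) (hAU : A ⊆ U) : ∃ T, G.IsRoot T ∧ A ⊆ T ∧ T ⊆ U := by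
  obtain ⟨X, hX, hAX⟩ := exists_superset_of_le h hA
  obtain ⟨T, hT, hXT⟩ := exists_isRoot hX
  obtain ⟨i, hi⟩ := F.nonempty_of_mem A hA
  exact ⟨T, hT, hAX.trans hXT, hU.subset_of_le h' hT.1 (hXT (hAX hi)) (hAU hi)⟩

/-- Carries an intermediate forest through a marked step: graft those of its trees that are caught
between `Aᵢ` and `Uᵢ`. -/
theorem exists_isJoin_between {F₀ G F₁ F F' : BinForest I} {A₁ A₂ U₁ U₂ : Finset I}
    (hj : IsJoin F' F₁ U₁ U₂) (hj' : IsJoin F F₀ A₁ A₂) (h₁ : A₁ ⊆ U₁) (h₂ : A₂ ⊆ U₂)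
    (h : F₀ ≤ G) (h' : G ≤ F₁) :
    ∃ K T₁ T₂, IsJoin K G T₁ T₂ ∧ A₁ ⊆ T₁ ∧ A₂ ⊆ T₂ ∧ T₁ ⊆ U₁ ∧ T₂ ⊆ U₂ := by
  obtain ⟨T₁, hT₁, hAT₁, hTU₁⟩ := exists_isRoot_between h h' hj'.root₁.1 hj.root₁ h₁
  obtain ⟨T₂, hT₂, hAT₂, hTU₂⟩ := exists_isRoot_between h h' hj'.root₂.1 hj.root₂ h₂
  have hne : T₁ ≠ T₂ := by
    rintro rfl
    obtain ⟨i, hi⟩ := G.nonempty_of_mem T₁ hT₁.1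
    exact Finset.disjoint_left.1 hj.disjoint (hTU₁ hi) (hTU₂ hi)
  exact ⟨_, T₁, T₂, G.isJoin_join hT₁ hT₂ hne, hAT₁, hAT₂, hTU₁, hTU₂⟩

/-- Guarantees chains that lose one inner vertex at a time, so that counting inner vertices gives
the rank and not merely an upper bound. -/
theorem exists_card_inn_add_one {F F' : BinForest I} (h : F ≤ F')
    (hc : F.inn.card < F'.inn.card) : ∃ G, F ≤ G ∧ G ≤ F' ∧ G.inn.card + 1 = F'.inn.card := by
  induction h using le_induction with
  | base F h => exact absurd hc (lt_irrefl _)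
  | unmarked F F' F₁ U₁ U₂ hj h ih => exact ⟨F₁, h, hj.le, hj.card_inn.symm⟩
  | marked F F₀ F' F₁ A₁ A₂ U₁ U₂ hj hj' h₁ h₂ h ih =>
    have e := hj.card_inn
    have e' := hj'.card_inn
    obtain ⟨G, hG, hG', hGc⟩ := ih (by omega)
    obtain ⟨K, T₁, T₂, hK, h₃, h₄, h₅, h₆⟩ := exists_isJoin_between hj hj' h₁ h₂ hG hG'
    have e'' := hK.card_inn
    exact ⟨K, hK.le_iff.2 (Or.inr ⟨F₀, A₁, A₂, hj', h₃, h₄, hG⟩),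
      hj.le_iff.2 (Or.inr ⟨G, T₁, T₂, hK, h₅, h₆, hG'⟩), by omega⟩

/-! ### Numbers of components -/

/-- The number of leaves minus the number of inner vertices of `F` which lie above a vertex with set
of ancestor leaves `A`. -/
def comps (F : BinForest I) (A : Finset I) : ℤ :=
  (A.card : ℤ) - ((F.inn.filter fun B => B ⊆ A).card : ℤ)

/-- Each vertex of `F` lies in a single tree of `F₁`, so those inside `U₁ ∪ U₂` split into those
inside `U₁` and those inside `U₂`. -/
theorem IsJoin.comps_union {F F₁ F' : BinForest I} {U₁ U₂ : Finset I} (hj : IsJoin F' F₁ U₁ U₂)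
    (h : F ≤ F₁) : F.comps (U₁ ∪ U₂) = F.comps U₁ + F.comps U₂ := by
  have e : (F.inn.filter fun B => B ⊆ U₁ ∪ U₂) =
      (F.inn.filter fun B => B ⊆ U₁) ∪ F.inn.filter fun B => B ⊆ U₂ := by
    ext B
    simp only [Finset.mem_filter, Finset.mem_union, ← and_or_left]
    refine and_congr_right fun hB => ⟨fun hs => ?_, fun hs => ?_⟩
    · obtain ⟨i, hi⟩ := F.nonempty_of_mem B (mem_inn.1 hB).1
      exact (Finset.mem_union.1 (hs hi)).imp
        (hj.root₁.subset_of_le h (mem_inn.1 hB).1 hi) (hj.root₂.subset_of_le h (mem_inn.1 hB).1 hi)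
    · exact hs.elim (fun h => h.trans Finset.subset_union_left)
        fun h => h.trans Finset.subset_union_right
  have hd : Disjoint (F.inn.filter fun B => B ⊆ U₁) (F.inn.filter fun B => B ⊆ U₂) := by
    refine Finset.disjoint_left.2 fun B hB hB' => ?_
    obtain ⟨hB, h₁⟩ := Finset.mem_filter.1 hB
    obtain ⟨i, hi⟩ := F.nonempty_of_mem B (mem_inn.1 hB).1
    exact Finset.disjoint_left.1 hj.disjoint (h₁ hi) ((Finset.mem_filter.1 hB').2 hi)
  rw [comps, e, Finset.card_union_of_disjoint hd, Finset.card_union_of_disjoint hj.disjoint,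
    comps, comps]
  push_cast
  ring

theorem IsJoin.comps_of_not_subset {F F₀ : BinForest I} {A₁ A₂ A : Finset I}
    (hj : IsJoin F F₀ A₁ A₂) (hA : ¬ A₁ ∪ A₂ ⊆ A) : F.comps A = F₀.comps A := by
  rw [comps, comps, hj.inn_eq, Finset.filter_insert, if_neg hA]

theorem IsJoin.comps_of_subset {F F₀ : BinForest I} {A₁ A₂ A : Finset I}
    (hj : IsJoin F F₀ A₁ A₂) (hA : A₁ ∪ A₂ ⊆ A) : F.comps A = F₀.comps A - 1 := by
  rw [comps, comps, hj.inn_eq, Finset.filter_insert, if_pos hA, Finset.card_insert_of_notMem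
    fun h => hj.union_notMem_inn (Finset.mem_filter.1 h).1]
  push_cast
  ring

theorem IsJoin.not_union_subset_of_subset {F F₀ F' F₁ : BinForest I} {A₁ A₂ U₁ U₂ V : Finset I}
    (hj : IsJoin F' F₁ U₁ U₂) (hj' : IsJoin F F₀ A₁ A₂) (h₁ : A₁ ⊆ U₁) (h₂ : A₂ ⊆ U₂)
    (hV : V ∈ F₁.verts) : ¬ A₁ ∪ A₂ ⊆ V := fun hs =>
  hj.not_union_subset hV ((hj.isLca_union h₁ h₂ (F₀.nonempty_of_mem _ hj'.root₁.1)
    (F₀.nonempty_of_mem _ hj'.root₂.1)).2.2 V (hj.mem hV) hs)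

/-- For such `A`, `comps` counts the trees of `F` inside `A`. A marked step merges two of them, and
each side contributes at least one. -/
theorem comps_pos {F F' : BinForest I} (h : F ≤ F') {A : Finset I} (hA : A ∈ F'.verts) :
    0 < F.comps A := by
  induction h using le_induction generalizing A with
  | base F h =>
    simpa [comps, h] using F.nonempty_of_mem A hA
  | unmarked F F' F₁ U₁ U₂ hj h ih =>
    rcases hj.mem_iff.1 hA with rfl | hA
    · rw [hj.comps_union h]
      exact add_pos (ih hj.root₁.1) (ih hj.root₂.1)
    · exact ih hA
  | marked F F₀ F' F₁ A₁ A₂ U₁ U₂ hj hj' h₁ h₂ h ih =>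
    rcases hj.mem_iff.1 hA with rfl | hA
    · rw [hj'.comps_of_subset (Finset.union_subset_union h₁ h₂), hj.comps_union h]
      have := ih hj.root₁.1
      have := ih hj.root₂.1
      omega
    · rw [hj'.comps_of_not_subset (hj.not_union_subset_of_subset hj' h₁ h₂ hA)]
      exact ih hA

/-- A binary tree has one more leaf than inner vertices. -/
theorem comps_self {F : BinForest I} {A : Finset I} (hA : A ∈ F.verts) : F.comps A = 1 := by
  induction F using join_induction generalizing A with
  | base F h =>
    rcases mem_inn_or_singleton hA with hA | ⟨i, rfl⟩
    · exact absurd hA (h ▸ Finset.notMem_empty A)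
    · simp [comps, h]
  | step F' F U₁ U₂ hj ih =>
    rcases hj.mem_iff.1 hA with rfl | hA
    · rw [hj.comps_of_subset subset_rfl, hj.comps_union le_rfl, ih hj.root₁.1, ih hj.root₂.1]
      rfl
    · rw [hj.comps_of_not_subset (hj.not_union_subset hA)]
      exact ih hA

open Classical in
/-- The trees of `F` above `U`. -/
noncomputable def roots (F : BinForest I) (U : Finset I) : Finset (Finset I) :=
  F.verts.filter fun T => F.IsRoot T ∧ T ⊆ U

theorem mem_roots {F : BinForest I} {U T : Finset I} : T ∈ F.roots U ↔ F.IsRoot T ∧ T ⊆ U := by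
  simp only [roots, Finset.mem_filter, and_iff_right_iff_imp]
  exact fun h => h.1.1

/-- The trees of `G` inside `U` partition its leaves and the vertices of `F` it contains. This makes
the sum over new grafts independent of `G`. -/
theorem comps_eq_sum {F G F' : BinForest I} (h : F ≤ G) (h' : G ≤ F') {U : Finset I}
    (hU : F'.IsRoot U) : ∑ T ∈ G.roots U, F.comps T = F.comps U := by
  have hdisj : ∀ T ∈ G.roots U, ∀ S ∈ G.roots U, ∀ i ∈ T, i ∈ S → T = S :=
    fun T hT S hS i hi hi' => (mem_roots.1 hT).1.eq (mem_roots.1 hS).1 hi hi'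
  have e₁ : U = (G.roots U).biUnion id := by
    ext i
    simp only [Finset.mem_biUnion, id]
    constructor
    · intro hi
      obtain ⟨T, hT, hiT, hTU⟩ := exists_isRoot_between h h' (F.singleton_mem i) hU
        (by simpa using hi)
      exact ⟨T, mem_roots.2 ⟨hT, hTU⟩, by simpa using hiT⟩
    · rintro ⟨T, hT, hi⟩
      exact (mem_roots.1 hT).2 hi
  have e₂ : (F.inn.filter fun B => B ⊆ U) =
      (G.roots U).biUnion fun T => F.inn.filter fun B => B ⊆ T := by
    ext B
    simp only [Finset.mem_biUnion, Finset.mem_filter]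
    constructor
    · rintro ⟨hB, hBU⟩
      obtain ⟨T, hT, hBT, hTU⟩ := exists_isRoot_between h h' (mem_inn.1 hB).1 hU hBU
      exact ⟨T, mem_roots.2 ⟨hT, hTU⟩, hB, hBT⟩
    · rintro ⟨T, hT, hB, hBT⟩
      exact ⟨hB, hBT.trans (mem_roots.1 hT).2⟩
  have c₁ : U.card = ∑ T ∈ G.roots U, T.card := by
    conv_lhs => rw [e₁]
    refine Finset.card_biUnion fun T hT S hS hne => Finset.disjoint_left.2 fun i hi hi' => ?_
    exact hne (hdisj T hT S hS i hi hi')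
  have c₂ : (F.inn.filter fun B => B ⊆ U).card =
      ∑ T ∈ G.roots U, (F.inn.filter fun B => B ⊆ T).card := by
    rw [e₂]
    refine Finset.card_biUnion fun T hT S hS hne => Finset.disjoint_left.2 fun B hB hB' => ?_
    obtain ⟨hB, hBT⟩ := Finset.mem_filter.1 hB
    obtain ⟨i, hi⟩ := F.nonempty_of_mem B (mem_inn.1 hB).1
    exact hne (hdisj T hT S hS i (hBT hi) ((Finset.mem_filter.1 hB').2 hi))
  simp only [comps]
  rw [c₁, c₂, Finset.sum_sub_distrib]
  push_cast
  rfl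

/-! ### Exponents of the non-marked vertices -/

/-- The roots of the subtrees grafted at a vertex. -/
def kids (F : BinForest I) (V : Finset I) : Finset (Finset I) :=
  F.verts.filter fun U => U ⊂ V ∧ ∀ B ∈ F.verts, U ⊂ B → ¬ B ⊂ V

/-- The exponent of a vertex of `F'` with respect to `F`. -/
def expo (F F' : BinForest I) (V : Finset I) : ℤ := ∏ U ∈ F'.kids V, F.comps U

open Classical in
/-- The inner vertices of `F'` to which no inner vertex of `F` is mapped. -/
noncomputable def nonMark (F F' : BinForest I) : Finset (Finset I) :=
  F'.inn.filter fun V => ∀ A ∈ F.inn, ¬ F'.IsLca A V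

theorem mem_nonMark {F F' : BinForest I} {V : Finset I} :
    V ∈ nonMark F F' ↔ V ∈ F'.inn ∧ ∀ A ∈ F.inn, ¬ F'.IsLca A V := by
  simp [nonMark]

theorem expo_pos {F F' : BinForest I} (h : F ≤ F') (V : Finset I) : 0 < expo F F' V :=
  Finset.prod_pos fun _ hU => comps_pos h (Finset.mem_filter.1 hU).1

theorem nonMark_self (F : BinForest I) : nonMark F F = ∅ :=
  Finset.eq_empty_of_forall_notMem fun V hV => (mem_nonMark.1 hV).2 V (mem_nonMark.1 hV).1
    ⟨(mem_inn.1 (mem_nonMark.1 hV).1).1, subset_rfl, fun _ _ h => h⟩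

/-! ### Children, marks and exponents after grafting -/

theorem IsJoin.kids_of_mem {F F' : BinForest I} {U₁ U₂ V : Finset I} (hj : IsJoin F' F U₁ U₂)
    (hV : V ∈ F.verts) : F'.kids V = F.kids V := by
  have hnot : ¬ U₁ ∪ U₂ ⊂ V := fun h => hj.not_union_subset hV h.1
  ext U
  simp only [kids, Finset.mem_filter, hj.mem_iff]
  constructor
  · rintro ⟨rfl | hU, hUV, hB⟩
    · exact absurd hUV hnot
    · exact ⟨hU, hUV, fun B hB' => hB B (Or.inr hB')⟩
  · rintro ⟨hU, hUV, hB⟩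
    refine ⟨Or.inr hU, hUV, ?_⟩
    rintro B (rfl | hB')
    · exact fun _ => hnot
    · exact hB B hB'

theorem IsJoin.kids_union {F F' : BinForest I} {U₁ U₂ : Finset I} (hj : IsJoin F' F U₁ U₂) :
    F'.kids (U₁ ∪ U₂) = {U₁, U₂} := by
  have hss : ∀ {U}, U ∈ F.verts → U ⊆ U₁ ∪ U₂ → U ⊂ U₁ ∪ U₂ := fun hU hs =>
    ⟨hs, hj.not_union_subset hU⟩
  have hmem : ∀ {B}, B ∈ F'.verts → B ⊂ U₁ ∪ U₂ → B ∈ F.verts := fun hB hs =>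
    (hj.mem_iff.1 hB).resolve_left hs.ne
  ext U
  simp only [kids, Finset.mem_filter, Finset.mem_insert, Finset.mem_singleton]
  constructor
  · rintro ⟨hU, hs, hB⟩
    rcases hj.subset_or (hmem hU hs) hs.1 with h | h
    · refine Or.inl (by_contra fun hne => hB U₁ (hj.mem hj.root₁.1)
        (Finset.ssubset_iff_subset_ne.2 ⟨h, hne⟩) (hss hj.root₁.1 Finset.subset_union_left))
    · refine Or.inr (by_contra fun hne => hB U₂ (hj.mem hj.root₂.1)
        (Finset.ssubset_iff_subset_ne.2 ⟨h, hne⟩) (hss hj.root₂.1 Finset.subset_union_right))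
  · rintro (rfl | rfl)
    · exact ⟨hj.mem hj.root₁.1, hss hj.root₁.1 Finset.subset_union_left, fun B hB hUB hBV =>
        hUB.ne (hj.root₁.2 B (hmem hB hBV) hUB.1).symm⟩
    · exact ⟨hj.mem hj.root₂.1, hss hj.root₂.1 Finset.subset_union_right, fun B hB hUB hBV =>
        hUB.ne (hj.root₂.2 B (hmem hB hBV) hUB.1).symm⟩

theorem IsJoin.expo_union {F F' F₁ : BinForest I} {U₁ U₂ : Finset I} (hj : IsJoin F' F₁ U₁ U₂) :
    expo F F' (U₁ ∪ U₂) = F.comps U₁ * F.comps U₂ := by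
  rw [expo, hj.kids_union, Finset.prod_pair hj.ne]

theorem IsJoin.expo_of_mem {F F' F₁ : BinForest I} {U₁ U₂ V : Finset I} (hj : IsJoin F' F₁ U₁ U₂)
    (hV : V ∈ F₁.verts) : expo F F' V = expo F F₁ V := by
  rw [expo, hj.kids_of_mem hV, expo]

theorem IsJoin.isLca_iff {F' F : BinForest I} {U₁ U₂ A V : Finset I} (hj : IsJoin F' F U₁ U₂)
    (hA : A.Nonempty) (hV : V ∈ F.verts) : F'.IsLca A V ↔ F.IsLca A V :=
  ⟨fun h => hj.isLca_of_mem h hV, hj.isLca_of_isLca hA⟩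

theorem IsJoin.nonMark_unmarked {F F' F₁ : BinForest I} {U₁ U₂ : Finset I}
    (hj : IsJoin F' F₁ U₁ U₂) (h : F ≤ F₁) :
    nonMark F F' = insert (U₁ ∪ U₂) (nonMark F F₁) := by
  ext V
  simp only [mem_nonMark, Finset.mem_insert, hj.mem_inn_iff]
  have key : ∀ V ∈ F₁.inn, ∀ A ∈ F.inn, (F'.IsLca A V ↔ F₁.IsLca A V) := fun V hV A hA =>
    hj.isLca_iff (F.nonempty_of_mem A (mem_inn.1 hA).1) (mem_inn.1 hV).1
  constructor
  · rintro ⟨rfl | hV, hA⟩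
    · exact Or.inl rfl
    · exact Or.inr ⟨hV, fun A hA' hl => hA A hA' ((key V hV A hA').2 hl)⟩
  · rintro (rfl | ⟨hV, hA⟩)
    · refine ⟨Or.inl rfl, fun A hA hl => ?_⟩
      obtain ⟨X, hX, hs⟩ := exists_superset_of_le h (mem_inn.1 hA).1
      exact hj.not_union_subset hX (hl.2.2 X (hj.mem hX) hs)
    · exact ⟨Or.inr hV, fun A hA' hl => hA A hA' ((key V hV A hA').1 hl)⟩

theorem IsJoin.nonMark_marked {F F₀ F' F₁ : BinForest I} {A₁ A₂ U₁ U₂ : Finset I}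
    (hj : IsJoin F' F₁ U₁ U₂) (hj' : IsJoin F F₀ A₁ A₂) (h₁ : A₁ ⊆ U₁) (h₂ : A₂ ⊆ U₂) :
    nonMark F F' = nonMark F₀ F₁ := by
  have hl := hj.isLca_union h₁ h₂ (F₀.nonempty_of_mem _ hj'.root₁.1)
    (F₀.nonempty_of_mem _ hj'.root₂.1)
  have key : ∀ V ∈ F₁.inn, ∀ A ∈ F₀.inn, (F'.IsLca A V ↔ F₁.IsLca A V) := fun V hV A hA =>
    hj.isLca_iff (F₀.nonempty_of_mem A (mem_inn.1 hA).1) (mem_inn.1 hV).1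
  ext V
  simp only [mem_nonMark, hj.mem_inn_iff, hj'.mem_inn_iff]
  constructor
  · rintro ⟨rfl | hV, hA⟩
    · exact absurd hl (hA _ (Or.inl rfl))
    · exact ⟨hV, fun A hA' h => hA A (Or.inr hA') ((key V hV A hA').2 h)⟩
  · rintro ⟨hV, hA⟩
    refine ⟨Or.inr hV, ?_⟩
    rintro A (rfl | hA') h
    · exact hj.union_notMem_inn (h.unique hl ▸ hV)
    · exact hA A hA' ((key V hV A hA').1 h)

/-- The function `g` is left arbitrary to serve both the weights (`-x`) and the polynomial factors
(`X - C x`). -/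
theorem IsJoin.prod_unmarked {M : Type*} [CommMonoid M] (g : ℤ → M) {F F' F₁ : BinForest I}
    {U₁ U₂ : Finset I} (hj : IsJoin F' F₁ U₁ U₂) (h : F ≤ F₁) :
    ∏ V ∈ nonMark F F', g (expo F F' V) =
      g (F.comps U₁ * F.comps U₂) * ∏ V ∈ nonMark F F₁, g (expo F F₁ V) := by
  rw [hj.nonMark_unmarked h, Finset.prod_insert fun h' => hj.union_notMem_inn (mem_nonMark.1 h').1,
    hj.expo_union]
  congr 1
  refine Finset.prod_congr rfl fun V hV => ?_
  rw [hj.expo_of_mem (mem_inn.1 (mem_nonMark.1 hV).1).1]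

/-- The extra inner vertex of `F` lies inside no vertex of `F₁`, so it changes none of the remaining
counts. -/
theorem IsJoin.prod_marked {M : Type*} [CommMonoid M] (g : ℤ → M) {F F₀ F' F₁ : BinForest I}
    {A₁ A₂ U₁ U₂ : Finset I} (hj : IsJoin F' F₁ U₁ U₂) (hj' : IsJoin F F₀ A₁ A₂) (h₁ : A₁ ⊆ U₁)
    (h₂ : A₂ ⊆ U₂) :
    ∏ V ∈ nonMark F F', g (expo F F' V) = ∏ V ∈ nonMark F₀ F₁, g (expo F₀ F₁ V) := by
  rw [hj.nonMark_marked hj' h₁ h₂]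
  refine Finset.prod_congr rfl fun V hV => ?_
  rw [hj.expo_of_mem (mem_inn.1 (mem_nonMark.1 hV).1).1, expo, expo]
  congr 1
  refine Finset.prod_congr rfl fun U hU => hj'.comps_of_not_subset ?_
  exact hj.not_union_subset_of_subset hj' h₁ h₂ (Finset.mem_filter.1 hU).1

/-- In building up the pair, the first unmarked vertex grafts two entire trees of `F`, each with
count 1; later steps keep its exponent. -/
theorem exists_expo_eq_one {F F' : BinForest I} (h : F ≤ F') (hne : F ≠ F') :
    ∃ V ∈ nonMark F F', expo F F' V = 1 := by
  induction h using le_induction with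
  | base F h => exact absurd rfl hne
  | unmarked F F' F₁ U₁ U₂ hj h ih =>
    rw [hj.nonMark_unmarked h]
    by_cases hF : F = F₁
    · subst hF
      refine ⟨_, Finset.mem_insert_self _ _, ?_⟩
      rw [hj.expo_union, comps_self hj.root₁.1, comps_self hj.root₂.1, one_mul]
    · obtain ⟨V, hV, hV'⟩ := ih hF
      refine ⟨V, Finset.mem_insert_of_mem hV, ?_⟩
      rw [hj.expo_of_mem (mem_inn.1 (mem_nonMark.1 hV).1).1, hV']
  | marked F F₀ F' F₁ A₁ A₂ U₁ U₂ hj hj' h₁ h₂ h ih =>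
    have hF : F₀ ≠ F₁ := by
      rintro rfl
      exact hne (hj.eq_of_subset hj' h₁ h₂)
    obtain ⟨V, hV, hV'⟩ := ih hF
    rw [hj.nonMark_marked hj' h₁ h₂]
    refine ⟨V, hV, ?_⟩
    rw [hj.expo_of_mem (mem_inn.1 (mem_nonMark.1 hV).1).1, ← hV', expo, expo]
    refine Finset.prod_congr rfl fun U hU => hj'.comps_of_not_subset ?_
    exact hj.not_union_subset_of_subset hj' h₁ h₂ (Finset.mem_filter.1 hU).1

end BinForest

/-! ### Möbius function and rank of a finite poset -/

/-- The sums over lower intervals determine the function recursively, so they characterize `μ(⊥,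
·)`. -/
theorem posetMu_bot_eq {P : Type*} [PartialOrder P] [OrderBot P] [Finite P] (w : P → ℤ)
    (hw : ∀ b, ∑ c ∈ (Set.toFinite (Set.Iic b)).toFinset, w c =
      open Classical in if ⊥ = b then 1 else 0) (b : P) : posetMu ⊥ b = w b := by
  classical
  let _ := Fintype.ofFinite P
  let _ : LocallyFiniteOrder P := Fintype.toLocallyFiniteOrder
  have e : ∀ b : P, posetMu ⊥ b = IncidenceAlgebra.mu ℤ ⊥ b := fun _ => rfl
  induction b using WellFoundedLT.induction with
  | _ b ih =>
    have h := hw b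
    have hI : (Set.toFinite (Set.Iic b)).toFinset = insert b (Finset.Ico ⊥ b) := by
      rw [Finset.Ico_insert_right bot_le]
      ext c
      simp
    have h' := IncidenceAlgebra.sum_Icc_mu_right (𝕜 := ℤ) (⊥ : P) b
    rw [← Finset.Ico_insert_right bot_le, Finset.sum_insert Finset.right_notMem_Ico] at h'
    rw [hI, Finset.sum_insert Finset.right_notMem_Ico] at h
    have hs : ∑ c ∈ Finset.Ico ⊥ b, w c = ∑ c ∈ Finset.Ico ⊥ b, IncidenceAlgebra.mu ℤ ⊥ c :=
      Finset.sum_congr rfl fun c hc => by rw [← ih c (Finset.mem_Ico.1 hc).2, e]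
    rw [e b]
    rw [hs] at h
    exact add_right_cancel (h'.trans h.symm)

/-- Strict monotonicity bounds the height above; descending by one from each nonzero value produces
a chain attaining the bound. -/
theorem posetRank_eq {P : Type*} [PartialOrder P] (r : P → ℕ) (hr : StrictMono r)
    (hpred : ∀ a, r a ≠ 0 → ∃ b, b < a ∧ r b + 1 = r a) (a : P) : posetRank a = r a := by
  have h : ∀ n a, r a = n → (n : ℕ∞) ≤ Order.height a := by
    intro n
    induction n with
    | zero => simp
    | succ n ih =>
      intro a ha
      obtain ⟨b, hb, hb'⟩ := hpred a (by omega)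
      have h1 := ih b (by omega)
      push_cast
      exact (by gcongr : (n : ℕ∞) + 1 ≤ Order.height b + 1).trans (Order.height_add_one_le hb)
  have h' := Order.height_le_height_apply_of_strictMono r hr a
  rw [Order.height_nat] at h'
  rw [posetRank, h'.antisymm (h _ a rfl), ENat.toNat_natCast]

namespace BinForest

variable {I : Type*} [DecidableEq I]

/-! ### The characteristic polynomial -/

/-- The forests between `F` and `F'`. -/
noncomputable def itv [Finite I] (F F' : BinForest I) : Finset (BinForest I) :=
  (Set.toFinite (Set.Icc F F')).toFinset

theorem mem_itv [Finite I] {F F' G : BinForest I} : G ∈ itv F F' ↔ F ≤ G ∧ G ≤ F' := by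
  simp [itv]

/-- The Möbius number of an interval, as a product over the non-marked vertices. -/
noncomputable def wt (F G : BinForest I) : ℤ := ∏ V ∈ nonMark F G, -expo F G V

/-- The characteristic polynomial of an interval, as a product over the non-marked vertices. -/
noncomputable def charProd (F F' : BinForest I) : Polynomial ℤ :=
  ∏ V ∈ nonMark F F', (Polynomial.X - Polynomial.C (expo F F' V))

open Polynomial in
theorem sum_wt_mul_pow_unmarked [Finite I] {F F' F₁ : BinForest I} {U₁ U₂ : Finset I}
    (hj : IsJoin F' F₁ U₁ U₂) (h : F ≤ F₁) :
    ∑ G ∈ itv F F', C (wt F G) * X ^ (F'.inn.card - G.inn.card) =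
      (X - C (F.comps U₁ * F.comps U₂)) *
        ∑ G ∈ itv F F₁, C (wt F G) * X ^ (F₁.inn.card - G.inn.card) := by
  classical
  have e := hj.card_inn
  have s₁ : ∑ G ∈ itv F F' with G ≤ F₁, C (wt F G) * X ^ (F'.inn.card - G.inn.card) =
      X * ∑ G ∈ itv F F₁, C (wt F G) * X ^ (F₁.inn.card - G.inn.card) := by
    have hi : (itv F F').filter (fun G => G ≤ F₁) = itv F F₁ := by
      ext G
      simp only [Finset.mem_filter, mem_itv]
      exact ⟨fun h => ⟨h.1.1, h.2⟩, fun h => ⟨⟨h.1, h.2.trans hj.le⟩, h.2⟩⟩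
    rw [hi, Finset.mul_sum]
    refine Finset.sum_congr rfl fun G hG => ?_
    -- The subtraction is truncated, so this bound is needed to split off one factor `X`.
    have := card_inn_le (mem_itv.1 hG).2
    rw [e, Nat.sub_add_comm this, pow_succ]
    ring
  -- The forests not below `F₁` are indexed by a forest of `[F, F₁]` and one of its trees inside
  -- each of `U₁`, `U₂`; the new vertex is unmarked.
  have s₂ : ∑ G ∈ itv F F' with ¬ G ≤ F₁, C (wt F G) * X ^ (F'.inn.card - G.inn.card) =
      ∑ p ∈ (itv F F₁).sigma fun G => G.roots U₁ ×ˢ G.roots U₂,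
        C (-(F.comps p.2.1 * F.comps p.2.2) * wt F p.1) *
          X ^ (F₁.inn.card - p.1.inn.card) := by
    have hex : ∀ p ∈ (itv F F₁).sigma fun G => G.roots U₁ ×ˢ G.roots U₂,
        F ≤ p.1 ∧ p.1 ≤ F₁ ∧ p.2.1 ⊆ U₁ ∧ p.2.2 ⊆ U₂ ∧ ∃ K, IsJoin K p.1 p.2.1 p.2.2 := by
      intro p hp
      simp only [Finset.mem_sigma, Finset.mem_product, mem_itv, mem_roots] at hp
      obtain ⟨⟨hG, hG'⟩, ⟨hr, hs⟩, hr', hs'⟩ := hp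
      refine ⟨hG, hG', hs, hs', _, p.1.isJoin_join hr hr' fun he => ?_⟩
      obtain ⟨i, hi⟩ := p.1.nonempty_of_mem _ hr.1
      exact Finset.disjoint_left.1 hj.disjoint (hs hi) (hs' (he ▸ hi))
    choose h₁ h₂ h₃ h₄ K hK using hex
    symm
    refine Finset.sum_bij K (fun p hp => ?_) (fun p hp q hq he => ?_) (fun G hG => ?_)
      fun p hp => ?_
    · simp only [Finset.mem_filter, mem_itv]
      exact ⟨⟨(h₁ p hp).trans (hK p hp).le, hj.le_iff.2 (Or.inr ⟨p.1, p.2.1, p.2.2, hK p hp,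
        h₃ p hp, h₄ p hp, h₂ p hp⟩)⟩, hj.not_le (hK p hp) (h₃ p hp) (h₄ p hp)⟩
    · have hq' := hK q hq
      rw [← he] at hq'
      obtain ⟨e₁, e₂, e₃⟩ := hj.unique (hK p hp) (h₃ p hp) (h₄ p hp) (h₂ q hq) hq'
        (h₃ q hq) (h₄ q hq)
      obtain ⟨G, T₁, T₂⟩ := p
      obtain ⟨H, S₁, S₂⟩ := q
      simp only at e₁ e₂ e₃
      rw [e₁, e₂, e₃]
    · simp only [Finset.mem_filter, mem_itv] at hG
      obtain ⟨⟨hFG, hG⟩, hG'⟩ := hG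
      obtain ⟨H, T₁, T₂, hH, h₁', h₂', hle⟩ := (hj.le_iff.1 hG).resolve_left hG'
      -- Otherwise `F` itself would have a vertex meeting both `U₁` and `U₂`, against `F ≤ F₁`.
      have hFH : F ≤ H := by
        refine (hH.le_iff.1 hFG).resolve_right ?_
        rintro ⟨F₀, A₁, A₂, hF₀, hA₁, hA₂, -⟩
        exact hj.not_le hF₀ (hA₁.trans h₁') (hA₂.trans h₂') h
      have hp : (⟨H, T₁, T₂⟩ : Σ _ : BinForest I, Finset I × Finset I) ∈
          (itv F F₁).sigma fun G => G.roots U₁ ×ˢ G.roots U₂ := by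
        simp only [Finset.mem_sigma, Finset.mem_product, mem_itv, mem_roots]
        exact ⟨⟨hFH, hle⟩, ⟨hH.root₁, h₁'⟩, hH.root₂, h₂'⟩
      exact ⟨_, hp, (hK _ hp).eq_of_eq hH⟩
    · have e' := (hK p hp).card_inn
      have hw : wt F (K p hp) = -(F.comps p.2.1 * F.comps p.2.2) * wt F p.1 :=
        (hK p hp).prod_unmarked (fun x => -x) (h₁ p hp)
      rw [hw, e, e', Nat.add_sub_add_right]
  rw [← Finset.sum_filter_add_sum_filter_not _ fun G => G ≤ F₁, s₁, s₂, sub_mul, sub_eq_add_neg]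
  congr 1
  -- For fixed `G` the sum over pairs of trees factors, and `comps_eq_sum` evaluates each factor.
  rw [Finset.sum_sigma, Finset.mul_sum, ← Finset.sum_neg_distrib]
  refine Finset.sum_congr rfl fun G hG => ?_
  have hG := mem_itv.1 hG
  rw [← comps_eq_sum hG.1 hG.2 hj.root₁, ← comps_eq_sum hG.1 hG.2 hj.root₂, Finset.sum_mul_sum,
    ← Finset.sum_product', map_sum, Finset.sum_mul, ← Finset.sum_neg_distrib]
  refine Finset.sum_congr rfl fun p _ => ?_
  simp only [map_mul, map_neg]
  ring

-- Grafting the trees singled out by `A₁`, `A₂` is a bijection from `[F₀, F₁]` to `[F, F']` that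
-- preserves weight and corank.
open Polynomial in
theorem sum_wt_mul_pow_marked [Finite I] {F F₀ F' F₁ : BinForest I} {A₁ A₂ U₁ U₂ : Finset I}
    (hj : IsJoin F' F₁ U₁ U₂) (hj' : IsJoin F F₀ A₁ A₂) (h₁ : A₁ ⊆ U₁) (h₂ : A₂ ⊆ U₂) :
    ∑ G ∈ itv F F', C (wt F G) * X ^ (F'.inn.card - G.inn.card) =
        ∑ G ∈ itv F₀ F₁, C (wt F₀ G) * X ^ (F₁.inn.card - G.inn.card) := by
  have hex : ∀ G ∈ itv F₀ F₁, ∃ K T₁ T₂, IsJoin K G T₁ T₂ ∧ A₁ ⊆ T₁ ∧ A₂ ⊆ T₂ ∧ T₁ ⊆ U₁ ∧ T₂ ⊆ U₂ :=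
    fun G hG => exists_isJoin_between hj hj' h₁ h₂ (mem_itv.1 hG).1 (mem_itv.1 hG).2
  choose K T₁ T₂ hK hA₁ hA₂ hU₁ hU₂ using hex
  symm
  refine Finset.sum_bij K (fun G hG => ?_) (fun G hG H hH he => ?_) (fun G hG => ?_)
    fun G hG => ?_
  · exact mem_itv.2 ⟨(hK G hG).le_iff.2 (Or.inr ⟨F₀, A₁, A₂, hj', hA₁ G hG, hA₂ G hG,
      (mem_itv.1 hG).1⟩), hj.le_iff.2 (Or.inr ⟨G, _, _, hK G hG, hU₁ G hG, hU₂ G hG,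
      (mem_itv.1 hG).2⟩)⟩
  · have hH' := hK H hH
    rw [← he] at hH'
    exact (hj.unique (hK G hG) (hU₁ G hG) (hU₂ G hG) (mem_itv.1 hH).2 hH' (hU₁ H hH) (hU₂ H hH)).1
  · obtain ⟨hFG, hG⟩ := mem_itv.1 hG
    have hF : ¬ F ≤ F₁ := hj.not_le hj' h₁ h₂
    obtain ⟨H, S₁, S₂, hH, hS₁, hS₂, hle⟩ := (hj.le_iff.1 hG).resolve_left fun h => hF (hFG.trans h)
    obtain ⟨F₂, B₁, B₂, hF₂, hB₁, hB₂, hle'⟩ :=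
      (hH.le_iff.1 hFG).resolve_left fun h => hF (h.trans hle)
    -- Here `F` is decomposed once relative to `F'` and once relative to `G`; uniqueness identifies
    -- the two, so `H` lies over `F₀`.
    obtain ⟨rfl, rfl, rfl⟩ := hj.unique hj' h₁ h₂ (hle'.trans hle) hF₂ (hB₁.trans hS₁)
      (hB₂.trans hS₂)
    have hmem := mem_itv.2 ⟨hle', hle⟩
    refine ⟨H, hmem, ?_⟩
    obtain ⟨i, hi⟩ := F₀.nonempty_of_mem _ hj'.root₁.1
    obtain ⟨k, hk⟩ := F₀.nonempty_of_mem _ hj'.root₂.1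
    have e₁ := (hK H hmem).root₁.eq hH.root₁ (hA₁ H hmem hi) (hB₁ hi)
    have e₂ := (hK H hmem).root₂.eq hH.root₂ (hA₂ H hmem hk) (hB₂ hk)
    rw [← e₁, ← e₂] at hH
    exact (hK H hmem).eq_of_eq hH
  · have hw : wt F (K G hG) = wt F₀ G :=
      (hK G hG).prod_marked (fun x => -x) hj' (hA₁ G hG) (hA₂ G hG)
    rw [hw, hj.card_inn, (hK G hG).card_inn, Nat.add_sub_add_right]

open Polynomial in
theorem sum_wt_mul_pow [Finite I] {F F' : BinForest I} (h : F ≤ F') :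
    ∑ G ∈ itv F F', C (wt F G) * X ^ (F'.inn.card - G.inn.card) = charProd F F' := by
  induction h using le_induction with
  | base F h =>
    have hi : itv F F = {F} := by
      ext G
      rw [mem_itv, Finset.mem_singleton]
      exact ⟨fun h => h.2.antisymm h.1, fun h => ⟨h.ge, h.le⟩⟩
    simp [hi, wt, charProd, nonMark_self]
  | unmarked F F' F₁ U₁ U₂ hj h ih =>
    rw [sum_wt_mul_pow_unmarked hj h, ih]
    exact (hj.prod_unmarked (fun x => X - C x) h).symm
  | marked F F₀ F' F₁ A₁ A₂ U₁ U₂ hj hj' h₁ h₂ h ih =>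
    rw [sum_wt_mul_pow_marked hj hj' h₁ h₂, ih]
    exact (hj.prod_marked (fun x => X - C x) hj' h₁ h₂).symm

/-- Evaluation at 1: the product is empty when `F = F'`, and otherwise an exponent equal to 1 kills
it. -/
theorem sum_wt [Finite I] {F F' : BinForest I} (h : F ≤ F') :
    ∑ G ∈ itv F F', wt F G = open Classical in if F = F' then 1 else 0 := by
  have e := congrArg (Polynomial.eval 1) (sum_wt_mul_pow h)
  simp only [Polynomial.eval_finsetSum, Polynomial.eval_mul, Polynomial.eval_C,
    Polynomial.eval_pow, Polynomial.eval_X, one_pow, mul_one] at e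
  rw [e, charProd]
  split_ifs with hF
  · subst hF
    simp [nonMark_self]
  · obtain ⟨V, hV, hV'⟩ := exists_expo_eq_one h hF
    rw [Polynomial.eval_prod]
    exact Finset.prod_eq_zero hV (by simp [hV'])

/-! ### The interval as a bounded poset -/

theorem posetMu_Icc [Finite I] {F F' : BinForest I} [Fact (F ≤ F')] (G : Set.Icc F F') :
    posetMu ⊥ G = wt F G.1 := by
  refine posetMu_bot_eq (fun G : Set.Icc F F' => wt F G.1) (fun G => ?_) G
  have hs : ∑ H ∈ (Set.toFinite (Set.Iic G)).toFinset, wt F H.1 = ∑ H ∈ itv F G.1, wt F H :=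
    Finset.sum_bij (fun H _ => H.1)
      (fun H hH => mem_itv.2 ⟨H.2.1, by simpa using hH⟩) (fun _ _ _ _ h => Subtype.ext h)
      (fun H hH => ⟨⟨H, (mem_itv.1 hH).1, (mem_itv.1 hH).2.trans G.2.2⟩,
        (Set.Finite.mem_toFinset _).2 (mem_itv.1 hH).2, rfl⟩) fun _ _ => rfl
  rw [hs, sum_wt G.2.1]
  by_cases h : F = G.1
  · rw [if_pos h, if_pos (Subtype.ext h : ⊥ = G)]
  · rw [if_neg h, if_neg fun h' : ⊥ = G => h (congrArg Subtype.val h')]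

theorem posetRank_Icc {F F' : BinForest I} (G : Set.Icc F F') :
    posetRank G = G.1.inn.card - F.inn.card := by
  refine posetRank_eq (fun G : Set.Icc F F' => G.1.inn.card - F.inn.card) (fun G H h => ?_)
    (fun G hG => ?_) G
  · have h1 := card_inn_lt (show G.1 < H.1 from h)
    have h2 := card_inn_le G.2.1
    simp only
    omega
  · obtain ⟨H, hH, hH', hc⟩ := exists_card_inn_add_one G.2.1 (by omega)
    have h2 := card_inn_le hH
    refine ⟨⟨H, hH, hH'.trans G.2.2⟩, lt_of_le_of_ne hH' fun h => ?_, ?_⟩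
    · have : H = G.1 := congrArg Subtype.val h
      rw [this] at hc
      omega
    · simp only
      omega

theorem posetCharPoly_Icc [Finite I] {F F' : BinForest I} [Fact (F ≤ F')] :
    posetCharPoly (Set.Icc F F') = charProd F F' := by
  have hle : F ≤ F' := Fact.out
  let _ := Fintype.ofFinite (Set.Icc F F')
  rw [← sum_wt_mul_pow hle, posetCharPoly]
  refine Finset.sum_bij (fun G _ => G.1) (fun G _ => mem_itv.2 G.2) (fun _ _ _ _ h => Subtype.ext h)
    (fun G hG => ⟨⟨G, mem_itv.1 hG⟩, Finset.mem_univ _, rfl⟩) fun G _ => ?_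
  have h1 := card_inn_le G.2.1
  have h2 := card_inn_le G.2.2
  rw [posetMu_Icc, posetCorank, posetRank_Icc, posetRank_Icc]
  congr 2
  change F'.inn.card - F.inn.card - _ = _
  omega

/-! ### Comparison with marked vertices -/

namespace Map

variable {F F' : BinForest I} (f : Map F F')

theorem mem_marked {w : F'.Vertex} : w ∈ f.marked ↔ ∃ A ∈ F.inn, F'.IsLca A w.1 := by
  simp only [marked, inner, Finset.mem_image, Finset.mem_filter, Finset.mem_univ, true_and]
  constructor
  · rintro ⟨v, hv, rfl⟩
    exact ⟨v.1, mem_inn.2 ⟨v.2, hv⟩, f.isLca v⟩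
  · rintro ⟨A, hA, hl⟩
    exact ⟨⟨A, (mem_inn.1 hA).1⟩, (mem_inn.1 hA).2, Subtype.ext ((f.isLca _).unique hl)⟩

theorem mem_nonMarked {w : F'.Vertex} : w ∈ f.nonMarked ↔ w.1 ∈ nonMark F F' := by
  rw [nonMarked, Finset.mem_sdiff, mem_marked, mem_nonMark, mem_inn, inner]
  simp only [Finset.mem_filter, Finset.mem_univ, true_and, not_exists, not_and]
  exact and_congr_left fun _ => ⟨fun h => ⟨w.2, h⟩, fun h => h.2⟩

/-- The image of an inner vertex is the least vertex containing it, so it lies inside `u` exactly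
when the vertex does; injectivity then equates the counts. -/
theorem subtreeCount_eq (u : F'.Vertex) : f.subtreeCount u = F.comps u.1 := by
  have hc : (f.marked.filter fun w => w ≤ u).card = (F.inn.filter fun B => B ⊆ u.1).card := by
    symm
    refine Finset.card_bij (fun A hA => f.toFun ⟨A, (mem_inn.1 (Finset.mem_filter.1 hA).1).1⟩)
      (fun A hA => ?_) (fun A hA B hB h => ?_) (fun w hw => ?_)
    · obtain ⟨hA, hAu⟩ := Finset.mem_filter.1 hA
      exact Finset.mem_filter.2 ⟨f.mem_marked.2 ⟨A, hA, f.isLca _⟩, (f.isLca _).2.2 u.1 u.2 hAu⟩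
    · exact congrArg Subtype.val (f.injOn_inner (mem_inn.1 (Finset.mem_filter.1 hA).1).2
        (mem_inn.1 (Finset.mem_filter.1 hB).1).2 h)
    · obtain ⟨hw, hwu⟩ := Finset.mem_filter.1 hw
      obtain ⟨A, hA, hl⟩ := f.mem_marked.1 hw
      exact ⟨A, Finset.mem_filter.2 ⟨hA, hl.2.1.trans hwu⟩, Subtype.ext ((f.isLca _).unique hl)⟩
  rw [subtreeCount, hc, comps]

theorem exponent_eq (v : F'.Vertex) : f.exponent v = expo F F' v.1 := by
  rw [exponent, expo]
  refine Finset.prod_bij (fun u _ => u.1) (fun u hu => ?_) (fun _ _ _ _ h => Subtype.ext h)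
    (fun U hU => ?_) fun u _ => f.subtreeCount_eq u
  · simp only [children, Finset.mem_filter, Finset.mem_univ, true_and] at hu
    exact Finset.mem_filter.2 ⟨u.2, hu.1, fun B hB h => hu.2 (c := ⟨B, hB⟩) h⟩
  · obtain ⟨hU, hUv, h⟩ := Finset.mem_filter.1 hU
    refine ⟨⟨U, hU⟩, ?_, rfl⟩
    simp only [children, Finset.mem_filter, Finset.mem_univ, true_and]
    exact ⟨hUv, fun B hB => h B.1 B.2 hB⟩

theorem prod_nonMarked {M : Type*} [CommMonoid M] (g : ℤ → M) :
    ∏ v ∈ f.nonMarked, g (f.exponent v) = ∏ V ∈ nonMark F F', g (expo F F' V) :=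
  Finset.prod_bij (fun v _ => v.1) (fun _ hv => f.mem_nonMarked.1 hv)
    (fun _ _ _ _ h => Subtype.ext h)
    (fun V hV => ⟨⟨V, (mem_inn.1 (mem_nonMark.1 hV).1).1⟩, f.mem_nonMarked.2 hV, rfl⟩)
    fun v _ => by rw [f.exponent_eq]

end Map

end BinForest

theorem mainTheorem1 {I : Type*} [Fintype I] [DecidableEq I] (F F' : BinForest I)
    [Fact (F ≤ F')] (f : BinForest.Map F F') :
    posetCharPoly (Set.Icc F F') =
        ∏ v ∈ f.nonMarked, (Polynomial.X - Polynomial.C (f.exponent v)) ∧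
      (∀ v ∈ f.nonMarked, 0 < f.exponent v) ∧
      ((posetCharPoly (Set.Icc F F')).map (Int.castRingHom ℂ)).roots =
        f.nonMarked.val.map (fun v => (f.exponent v : ℂ)) ∧
      moebiusNumber (Set.Icc F F') =
        (-1) ^ f.nonMarked.card * ∏ v ∈ f.nonMarked, f.exponent v := by
  have hle : F ≤ F' := Fact.out
  have h : posetCharPoly (Set.Icc F F') =
      ∏ v ∈ f.nonMarked, (Polynomial.X - Polynomial.C (f.exponent v)) := by
    rw [BinForest.posetCharPoly_Icc, f.prod_nonMarked fun x => Polynomial.X - Polynomial.C x]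
    rfl
  refine ⟨h, fun v _ => ?_, ?_, ?_⟩
  · rw [f.exponent_eq]
    exact BinForest.expo_pos hle v.1
  · rw [h, Polynomial.map_prod,
      ← Polynomial.roots_multiset_prod_X_sub_C (f.nonMarked.val.map fun v => (f.exponent v : ℂ)),
      Multiset.map_map]
    exact congrArg _ (Finset.prod_congr rfl fun v _ => by simp)
  -- The Möbius number is the weight of the top element `F'`; the signs are collected into a power
  -- of `-1`.
  · rw [moebiusNumber, BinForest.posetMu_Icc, ← Finset.prod_neg,
      f.prod_nonMarked fun x => -x]
    rfl
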